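/- Let $\mathbf N$ be the set of locally finite simple counting measures on $\mathbb R^d$ (identified with their supports), with the $\sigma$-field generated by the maps $\phi\mapsto\phi(B)$, $B$ Borel; put $(\theta_t\phi)(B)=\phi(B+t)$ and $\mathbf N^0=\{\phi\in\mathbf N:0\in\phi\}$. A point-map is a measurable map $f:\mathbf N^0\to\mathbb R^d$ with $f(\phi)\in\phi$; its point-shift $F$ is given by $F_\phi(x)=f(\theta_x\phi)+x$ for $x\in\phi$, and $\theta_f\phi:=\theta_{f(\phi)}\phi$ on $\mathbf N^0$. The $F$-foil of $x\in\phi$ is $L^F(x)=\{y\in\phi:\exists n\ge 0,\ F_\phi^n(x)=F_\phi^n(y)\}$ and its component is $C^F(x)=\{y\in\phi:\exists m,n\ge 0,\ F_\phi^m(x)=F_\phi^n(y)\}$. For a stationary point process $(\Phi,\mathbb P)$ on $\mathbb R^d$, the stable group $\Gamma_L^F$ is the set of point-shifts $H$ such that, $\mathbb P$-a.s., $H_\Phi$ is a bijection of $\Phi$ and $H_\Phi^{-1}(T)=T$ for every $F$-foil $T$; $H\in\Gamma_L^F$ is dense if, $\mathbb P$-a.s., $\{H_\Phi^n(x):n\in\mathbb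 Z\}=L^F(x)$ for all $x\in\Phi$. A dense $H$ induces on each infinite foil the total order $\preceq_H$ given by $x\preceq_H y$ iff $y=H_\Phi^n(x)$ for some $n\ge 0$. Let $(\Phi,\mathbb P)$ be a stationary point process on $\mathbb R^d$ with finite intensity and let $F$ be a point-shift. (1) There is a dense element $F_\bot$ of $\Gamma_L^F$ such that moreover, $\mathbb P$-a.s., on every component all of whose $F$-foils are infinite, the order $\preceq_{F_\bot}$ is preserved by $F$, i.e. $x\preceq_{F_\bot}y$ implies $F_\Phi(x)\preceq_{F_\bot}F_\Phi(y)$. It can in addition be chosen such that on each foil of these components $\preceq_{F_\bot}$ is the order of the Royal Line of Succession, i.e. the depth-first pre-order for the trees in which $F_\Phi(x)$ is the father of $x$ and brothers are visited in increasing lexicographic order: an ancestor comes before its descendants, and if the ancestral lines of $x$ and $y$ merge through two distinct brothers, then $x$ comes before $y$ iff the brother on the line of $x$ is lexicographically smaller. (2) If the intensity $\lambda$ is also positive, let $\mathbb P_\Phi$ be the Palm distribution on $\mathbf N^0$, $\mathbb P_\Phi(B)=\lambda^{-1}\,\mathbb E\sum_{x\in\Phi\cap[0,1)^d}\mathbf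 1_B(\theta_x\Phi)$, a probability measure. For every $H\in\Gamma_L^F$ with point-map $h$ (in particular for $F_\bot$ and its point-map $f_\bot$), the map $\theta_h$ preserves $\mathbb P_\Phi$, and the law of the point foil is preserved too: under $\mathbb P_\Phi$, the translate $\theta_{h(\phi)}L^F(0)$ of the foil of the origin has the same distribution as $L^F(0)$. (3) There is no uniqueness in general: for every $d\ge 1$ there are a stationary point process on $\mathbb R^d$ with finite positive intensity, a point-shift $F$, and two dense elements of $\Gamma_L^F$, both with the order preservation property of (1), which are not $\mathbb P$-a.s. equal on $\Phi$. -/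

import Mathlib

open MeasureTheory ProbabilityTheory
open scoped ENNReal

noncomputable section

namespace PointFoil

/-! ### Foils and components of a self-map -/

section Dynamics

variable {X : Type*}

/-- The foil of `x`: the class of `x` for the relation `∃ n, g^n x = g^n y`. -/
def foil (g : X → X) (x : X) : Set X := {y | ∃ n : ℕ, g^[n] x = g^[n] y}

/-- The undirected connected component of `x` in the graph with edges `(z, g z)`. -/
def component (g : X → X) (x : X) : Set X := {y | ∃ m n : ℕ, g^[m] x = g^[n] y}

/-- The self-map `h` preserves the partition into `g`-foils: `h⁻¹(T) = T` for each foil `T`. -/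
def PreservesFoils (g h : X → X) : Prop := ∀ x, h ⁻¹' foil g x = foil g x

/-- The two-sided orbit `{h^n x ; n ∈ ℤ}` of a bijection `h`. -/
def orbitZ (h : X → X) (hb : Function.Bijective h) (x : X) : Set X :=
  Set.range fun n : ℤ => ((Equiv.ofBijective h hb : Equiv.Perm X) ^ n) x

/-- The relation `x ⪯_h y` generated by `x ⪯_h h x`; it is a total order on every infinite
two-sided orbit of a bijection `h`. -/
def orbitLE (h : X → X) (x y : X) : Prop := ∃ n : ℕ, h^[n] x = y

end Dynamics

/-! ### Simple locally finite counting measures -/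

/-- The Euclidean space `ℝ^d`. -/
abbrev Space (d : ℕ) : Type := EuclideanSpace ℝ (Fin d)

/-- The space `𝐍` of simple locally finite counting measures on `ℝ^d`, each identified with its
support. -/
@[ext]
structure Config (d : ℕ) where
  carrier : Set (Space d)
  finite_inter : ∀ B : Set (Space d), Bornology.IsBounded B → (carrier ∩ B).Finite

/-- The counting measure with support `φ`. -/
def Config.toMeasure {d : ℕ} (φ : Config d) : Measure (Space d) :=
  Measure.count.restrict φ.carrier

/-- The σ-field generated by the maps `φ ↦ φ(B)`, `B` Borel (the σ-field of Mathlib on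
measures is generated by the evaluations). -/
instance (d : ℕ) : MeasurableSpace (Config d) :=
  MeasurableSpace.comap Config.toMeasure inferInstance

/-- The subspace `𝐍⁰` of the counting measures with an atom at the origin. -/
abbrev Config0 (d : ℕ) : Type := {φ : Config d // (0 : Space d) ∈ φ.carrier}

/-- The translation `θ_t φ`, with `(θ_t φ)(B) = φ(B + t)`. -/
def translate {d : ℕ} (t : Space d) (φ : Config d) : Config d where
  carrier := {y | y + t ∈ φ.carrier}
  finite_inter B hB := by
    have h := φ.finite_inter ((fun y => y + t) '' B) (by
      obtain ⟨C, hC⟩ := hB.exists_norm_le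
      refine (Metric.isBounded_closedBall (x := (0 : Space d)) (r := C + ‖t‖)).subset ?_
      rintro _ ⟨y, hy, rfl⟩
      simpa using (norm_add_le y t).trans (by gcongr; exact hC y hy))
    refine Set.Finite.of_finite_image (f := fun y => y + t) (h.subset ?_)
      (add_left_injective t).injOn
    rintro _ ⟨y, ⟨hy, hyB⟩, rfl⟩
    exact ⟨hy, y, hyB, rfl⟩

/-- `θ_x φ` for a point `x` of `φ`, as an element of `𝐍⁰`. -/
def recenter {d : ℕ} (φ : Config d) (x : φ.carrier) : Config0 d :=
  ⟨translate x.1 φ, by simp [translate]⟩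

/-! ### Point-maps and point-shifts -/

/-- A point-map: a measurable map `f : 𝐍⁰ → ℝ^d` with `f φ ∈ φ`. -/
structure PointMap (d : ℕ) where
  toFun : Config0 d → Space d
  measurable' : Measurable toFun
  mem' : ∀ φ : Config0 d, toFun φ ∈ φ.1.carrier

/-- The (flow-adapted) point-shift of a point-map: `F_φ(x) = f(θ_x φ) + x`, a self-map of the
support of `φ`. -/
def PointMap.shift {d : ℕ} (f : PointMap d) (φ : Config d) (x : φ.carrier) : φ.carrier :=
  ⟨f.toFun (recenter φ x) + x.1, f.mem' (recenter φ x)⟩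

/-- The map `θ_f : 𝐍⁰ → 𝐍⁰`, `φ ↦ θ_{f(φ)} φ`. -/
def PointMap.theta {d : ℕ} (f : PointMap d) (φ : Config0 d) : Config0 d :=
  recenter φ.1 ⟨f.toFun φ, f.mem' φ⟩

/-- The foil of the origin, as a counting measure. -/
def PointMap.originFoil {d : ℕ} (f : PointMap d) (φ : Config0 d) : Config d where
  carrier := Subtype.val '' foil (f.shift φ.1) ⟨0, φ.2⟩
  finite_inter B hB := (φ.1.finite_inter B hB).subset (by
    rintro _ ⟨⟨x, -, rfl⟩, hx⟩
    exact ⟨x.2, hx⟩)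

/-! ### Stationary point processes and Palm distributions -/

variable {d : ℕ} {Ω : Type*} [MeasurableSpace Ω]

/-- `Φ` is a stationary point process under `P`. -/
def IsStationaryPointProcess (P : Measure Ω) (Φ : Ω → Config d) : Prop :=
  Measurable Φ ∧ ∀ t : Space d, P.map (fun ω => translate t (Φ ω)) = P.map Φ

/-- The unit cube `[0,1)^d`. -/
def unitCube (d : ℕ) : Set (Space d) := {x | ∀ i, x i ∈ Set.Ico (0 : ℝ) 1}

/-- The intensity: the mean number of points in the unit cube. -/
def intensity (P : Measure Ω) (Φ : Ω → Config d) : ℝ≥0∞ :=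
  ∫⁻ ω, (Φ ω).toMeasure (unitCube d) ∂P

/-- The Palm distribution on `𝐍⁰`,
`B ↦ λ⁻¹ E [∑_{x ∈ Φ ∩ [0,1)^d} 1_B(θ_x Φ)]`, with `λ` the intensity. -/
def palm (P : Measure Ω) (Φ : Ω → Config d) : Measure (Config0 d) :=
  (intensity P Φ)⁻¹ • P.bind fun ω =>
    Measure.sum fun x : {x : (Φ ω).carrier // x.1 ∈ unitCube d} =>
      Measure.dirac (recenter (Φ ω) x.1)

/-! ### Stable group, dense elements, order preservation -/

/-- The point-shift of `h` belongs to the stable group of the `F`-foliation: almost surely, it is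
bijective and preserves the foils. -/
def InFoilStableGroup (P : Measure Ω) (Φ : Ω → Config d) (f h : PointMap d) : Prop :=
  ∀ᵐ ω ∂P, Function.Bijective (h.shift (Φ ω)) ∧
    PreservesFoils (f.shift (Φ ω)) (h.shift (Φ ω))

/-- The point-shift of `h` is dense for the `F`-foliation: almost surely, the orbit of each
point is its foil. -/
def IsFoilDense (P : Measure Ω) (Φ : Ω → Config d) (f h : PointMap d) : Prop :=
  ∀ᵐ ω ∂P, ∃ hb : Function.Bijective (h.shift (Φ ω)),
    ∀ x, orbitZ (h.shift (Φ ω)) hb x = foil (f.shift (Φ ω)) x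

/-- All foils of the component of `x` are infinite. -/
def AllFoilsInfinite (f : PointMap d) (φ : Config d) (x : φ.carrier) : Prop :=
  ∀ z ∈ component (f.shift φ) x, (foil (f.shift φ) z).Infinite

/-- Almost surely, on the components whose foils are all infinite, the order induced by the
point-shift of `h` is preserved by the point-shift of `f`. -/
def IsOrderPreserved (P : Measure Ω) (Φ : Ω → Config d) (f h : PointMap d) : Prop :=
  ∀ᵐ ω ∂P, ∀ x, AllFoilsInfinite f (Φ ω) x → ∀ y,
    orbitLE (h.shift (Φ ω)) x y →
      orbitLE (h.shift (Φ ω)) (f.shift (Φ ω) x) (f.shift (Φ ω) y)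

/-- The lexicographic order of `ℝ^d`. -/
def lexLT (x y : Space d) : Prop := toLex (fun i => x i) < toLex (fun i => y i)

/-- The order of the royal line of succession: depth-first pre-order in the tree where the father
of `x` is `g x` and where brothers are visited in lexicographic order. On an acyclic component,
`x` is visited no later than `y` iff `x` is `y` or an ancestor of `y`, or the ancestral lines
of `x` and `y` merge through two distinct brothers of which that of `x` comes first. -/
def rlsLE {φ : Config d} (g : φ.carrier → φ.carrier) (x y : φ.carrier) : Prop :=
  (∃ k : ℕ, g^[k] y = x) ∨
    ∃ m n : ℕ, g^[m + 1] x = g^[n + 1] y ∧ lexLT (g^[m] x).1 (g^[n] y).1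

/-- Almost surely, on the foils of the components whose foils are all infinite, the order
induced by the point-shift of `h` is that of the royal line of succession. -/
def IsRoyalLine (P : Measure Ω) (Φ : Ω → Config d) (f h : PointMap d) : Prop :=
  ∀ᵐ ω ∂P, ∀ x, AllFoilsInfinite f (Φ ω) x → ∀ y ∈ foil (f.shift (Φ ω)) x,
    (orbitLE (h.shift (Φ ω)) x y ↔ rlsLE (f.shift (Φ ω)) x y)

end PointFoil

end

open MeasureTheory ProbabilityTheory
open scoped ENNReal

noncomputable section

namespace PointFoil

variable {d : ℕ}

/-! ### The counting kernel and measurability of quantifiers over points -/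

/-! Two points of one foil merge after the same number of steps; when they differ, their lines merge
through two distinct brothers. Comparing these brothers gives a strict total order `prec` on each
foil. It is preserved by the point-shift up to merging (`prec.map`), and its intervals are finite as
soon as every point has finitely many preimages (`finite_prec_interval`). If moreover every infinite
foil has neither a greatest nor a least point, infinite foils are ordered like the integers. The
successor, closed up cyclically on finite foils, is then a bijection whose orbits are the foils.

These conditions, `IsTame`, hold almost surely by mass transport (`mass_transport`): if every point
sends at most one unit of mass, finite intensity forces every point to receive finite mass. Points
send their mass to their image, or to the greatest, least or periodic point of their foil, which is
unique if it exists. In the last three cases the receiver gets a unit from its whole foil, which is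
therefore finite. An infinite foil thus has no periodic point, so merging lines have equal lengths,
and for the lexicographic order `prec` becomes the royal line of succession (`rlsLE_iff`).

The same principle gives Mecke's theorem `measurePreserving_theta`: a bijective point-shift
preserves the Palm distribution. An element of the stable group moves the origin within its foil, so
the translated foil is the origin foil composed with `theta`, and its law is preserved.

The construction works for every translation-invariant measurable total order of brothers. The
lexicographic order and its reverse give successors that differ at each point of an infinite foil.
Infinite foils occur almost surely in a superposition of randomly shifted lattices of mesh `2 ^ k`,
each point being sent to the corner of its cube of the next lattice. -/

theorem Config.countable_carrier (φ : Config d) : φ.carrier.Countable := by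
  have h : φ.carrier = ⋃ n : ℕ, φ.carrier ∩ Metric.closedBall 0 n := by
    ext x
    simp only [Set.mem_iUnion, Set.mem_inter_iff, mem_closedBall_zero_iff]
    exact ⟨fun hx => (exists_nat_ge ‖x‖).imp fun n hn => ⟨hx, hn⟩, fun ⟨_, hx, _⟩ => hx⟩
  rw [h]
  exact Set.countable_iUnion fun n => (φ.finite_inter _ Metric.isBounded_closedBall).countable

theorem Config.measurableSet_carrier (φ : Config d) : MeasurableSet φ.carrier :=
  φ.countable_carrier.measurableSet

theorem Config.toMeasure_apply (φ : Config d) (s : Set (Space d)) :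
    φ.toMeasure s = Measure.count (s ∩ φ.carrier) :=
  Measure.restrict_apply' φ.measurableSet_carrier

theorem Config.toMeasure_eq_zero (φ : Config d) {s : Set (Space d)} :
    φ.toMeasure s = 0 ↔ ∀ x ∈ φ.carrier, x ∉ s := by
  rw [φ.toMeasure_apply, Measure.count_eq_zero_iff, Set.eq_empty_iff_forall_notMem]
  simp only [Set.mem_inter_iff, not_and]
  exact forall_congr' fun x => ⟨fun h hx hs => h hs hx, fun h hs hx => h hx hs⟩

theorem Config.toMeasure_eq_top (φ : Config d) {s : Set (Space d)} :
    φ.toMeasure s = ∞ ↔ (s ∩ φ.carrier).Infinite := by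
  rw [φ.toMeasure_apply, Measure.count_apply_eq_top]

theorem Config.toMeasure_le_one (φ : Config d) {s : Set (Space d)}
    (h : (s ∩ φ.carrier).Subsingleton) : φ.toMeasure s ≤ 1 := by
  rw [φ.toMeasure_apply]
  rcases h.eq_empty_or_singleton with h | ⟨x, h⟩ <;> simp [h]

theorem Config.toMeasure_eq_one (φ : Config d) {s : Set (Space d)} {x : Space d}
    (h : s ∩ φ.carrier = {x}) : φ.toMeasure s = 1 := by
  rw [φ.toMeasure_apply, h, Measure.count_singleton]

theorem Config.ae_toMeasure (φ : Config d) {p : Space d → Prop} :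
    (∀ᵐ x ∂φ.toMeasure, p x) ↔ ∀ x ∈ φ.carrier, p x := by
  rw [ae_iff, φ.toMeasure_eq_zero]
  simp

theorem measurable_toMeasure : Measurable (Config.toMeasure (d := d)) :=
  comap_measurable _

theorem measurable_config {α : Type*} [MeasurableSpace α] {c : α → Config d}
    (h : ∀ B, MeasurableSet B → Measurable fun a => (c a).toMeasure B) : Measurable c :=
  measurable_comap_iff.2 (Measure.measurable_of_measurable_coe _ h)

/-- A configuration, as a kernel from the space of configurations. -/
def pointKernel (d : ℕ) : Kernel (Config d) (Space d) := ⟨Config.toMeasure, measurable_toMeasure⟩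

theorem pointKernel_apply (φ : Config d) : pointKernel d φ = φ.toMeasure := rfl

/-- The annuli `n ≤ ‖x‖ < n + 1`. -/
def annulus (d n : ℕ) : Set (Space d) := {x | ⌊‖x‖⌋₊ = n}

theorem measurableSet_annulus (n : ℕ) : MeasurableSet (annulus d n) :=
  (Nat.measurable_floor.comp measurable_norm) (measurableSet_singleton n)

theorem Config.toMeasure_annulus (φ : Config d) (n : ℕ) : φ.toMeasure (annulus d n) ≠ ∞ := by
  rw [Ne, φ.toMeasure_eq_top, Set.not_infinite]
  refine (φ.finite_inter (Metric.closedBall 0 (n + 1)) Metric.isBounded_closedBall).subset ?_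
  rintro x ⟨hx, hφ⟩
  refine ⟨hφ, mem_closedBall_zero_iff.2 ?_⟩
  have := Nat.lt_floor_add_one ‖x‖
  rw [annulus, Set.mem_ofPred_eq] at hx
  rw [hx] at this
  exact this.le

theorem measurableSet_annulusFloor (n m : ℕ) :
    MeasurableSet {φ : Config d | ⌊(φ.toMeasure (annulus d n)).toReal⌋₊ = m} :=
  (Nat.measurable_floor.comp ((Measure.measurable_coe (measurableSet_annulus n)).comp
    measurable_toMeasure).ennreal_toReal) (measurableSet_singleton m)

/-- The number of points in an annulus is finite but not bounded in `φ`, so annuli alone do not give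
finite kernels. Splitting also by the integer part `m` of this number bounds each piece by `m + 1`.
S-finiteness underlies Tonelli's theorem and all measurability statements below. -/
instance (d : ℕ) : IsSFiniteKernel (pointKernel d) := by
  classical
  let κ : ℕ × ℕ → Kernel (Config d) (Space d) := fun p =>
    Kernel.piecewise (measurableSet_annulusFloor p.1 p.2)
      ((pointKernel d).restrict (measurableSet_annulus p.1)) 0
  have hκ : ∀ p, IsFiniteKernel (κ p) := by
    rintro ⟨n, m⟩
    refine ⟨(m + 1 : ℝ≥0∞), by simp, fun φ => ?_⟩
    simp only [κ, Kernel.piecewise_apply]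
    split_ifs with h
    · rw [Kernel.restrict_apply, Measure.restrict_apply_univ, pointKernel_apply,
        ← ENNReal.ofReal_toReal (φ.toMeasure_annulus n)]
      have := Nat.lt_floor_add_one (φ.toMeasure (annulus d n)).toReal
      rw [Set.mem_ofPred_eq] at h
      rw [h] at this
      calc _ ≤ ENNReal.ofReal ((m : ℝ) + 1) := ENNReal.ofReal_le_ofReal this.le
        _ = _ := by rw [ENNReal.ofReal_add (by positivity) zero_le_one]; simp
    · simp
  have : pointKernel d = Kernel.sum κ := by
    ext φ B hB
    rw [Kernel.sum_apply' _ _ hB, ENNReal.tsum_prod', pointKernel_apply]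
    have h1 : ∀ n, ∑' m, κ (n, m) φ B = φ.toMeasure (B ∩ annulus d n) := by
      intro n
      rw [tsum_eq_single ⌊(φ.toMeasure (annulus d n)).toReal⌋₊]
      · simp [κ, Kernel.piecewise_apply, Kernel.restrict_apply, Measure.restrict_apply hB,
          pointKernel_apply]
      · intro m hm
        simp [κ, Kernel.piecewise_apply, hm.symm]
    simp_rw [h1]
    rw [← measure_iUnion, ← Set.inter_iUnion]
    · congr 1
      ext x
      simp [annulus]
    · intro i j hij
      refine Set.disjoint_left.2 ?_
      rintro x ⟨-, hi⟩ ⟨-, hj⟩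
      exact hij (hi.symm.trans hj)
    · exact fun n => hB.inter (measurableSet_annulus n)
  rw [this]
  infer_instance

instance (φ : Config d) : SFinite φ.toMeasure :=
  inferInstanceAs (SFinite (pointKernel d φ))

section Quantifiers

variable {α : Type*} [MeasurableSpace α] {c : α → Config d}

theorem Measurable.lintegral_config (hc : Measurable c) {g : α → Space d → ℝ≥0∞}
    (hg : Measurable fun q : α × Space d => g q.1 q.2) :
    Measurable fun a => ∫⁻ x, g a x ∂(c a).toMeasure :=
  hg.lintegral_kernel_prod_right (κ := (pointKernel d).comap c hc)

theorem Measurable.toMeasure_setOf (hc : Measurable c) {p : α → Space d → Prop}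
    (hp : Measurable fun q : α × Space d => p q.1 q.2) :
    Measurable fun a => (c a).toMeasure {x | p a x} :=
  Kernel.measurable_kernel_prodMk_left (κ := (pointKernel d).comap c hc)
    (measurableSet_setOfPred.2 hp)

/-- A quantifier over the points of a random configuration says that a counting measure does or does
not vanish on a section, so it is measurable although the set of candidates is uncountable. -/
theorem Measurable.exists_mem_config (hc : Measurable c) {p : α → Space d → Prop}
    (hp : Measurable fun q : α × Space d => p q.1 q.2) :
    Measurable fun a => ∃ x ∈ (c a).carrier, p a x := by
  have h : (fun a => ∃ x ∈ (c a).carrier, p a x) = fun a => ¬ (c a).toMeasure {x | p a x} = 0 := by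
    ext a
    simp [(c a).toMeasure_eq_zero]
  rw [h]
  exact (measurableSet_setOfPred.1
    ((Measurable.toMeasure_setOf hc hp) (measurableSet_singleton 0))).not

theorem Measurable.forall_mem_config (hc : Measurable c) {p : α → Space d → Prop}
    (hp : Measurable fun q : α × Space d => p q.1 q.2) :
    Measurable fun a => ∀ x ∈ (c a).carrier, p a x := by
  have h : (fun a => ∀ x ∈ (c a).carrier, p a x) = fun a => ¬ ∃ x ∈ (c a).carrier, ¬ p a x := by
    ext a
    simp
  rw [h]
  exact (Measurable.exists_mem_config hc hp.not).not

theorem measurable_prop_eq {β : Type*} [MeasurableSpace β] [MeasurableEq β] {u v : α → β}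
    (hu : Measurable u) (hv : Measurable v) : Measurable fun a => u a = v a :=
  measurableSet_setOfPred.1 (measurableSet_eq_fun hu hv)

theorem Measurable.mem_config (hc : Measurable c) {x : α → Space d} (hx : Measurable x) :
    Measurable fun a => x a ∈ (c a).carrier := by
  have h : (fun a => x a ∈ (c a).carrier) = fun a => ∃ y ∈ (c a).carrier, y = x a := by
    ext a
    simp
  rw [h]
  exact Measurable.exists_mem_config hc
    (measurable_prop_eq measurable_snd (hx.comp measurable_fst))

end Quantifiers

/-! ### Translations -/

theorem mem_translate {t x : Space d} {φ : Config d} :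
    x ∈ (translate t φ).carrier ↔ x + t ∈ φ.carrier := Iff.rfl

theorem toMeasure_translate (t : Space d) (φ : Config d) :
    (translate t φ).toMeasure = φ.toMeasure.map fun x => x - t := by
  ext B hB
  rw [Measure.map_apply (by fun_prop) hB, Config.toMeasure_apply,
    Config.toMeasure_apply, ← Measure.count_injective_image (f := fun x => x + t)
      (add_left_injective t)]
  congr 1
  ext x
  constructor
  · rintro ⟨y, ⟨hB, hy⟩, rfl⟩
    exact ⟨by simpa using hB, hy⟩
  · rintro ⟨hB, hy⟩
    exact ⟨x - t, ⟨hB, by simpa [translate] using hy⟩, by simp⟩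

theorem translate_translate (s t : Space d) (φ : Config d) :
    translate s (translate t φ) = translate (s + t) φ := by
  ext x
  simp [translate, add_assoc]

theorem measurable_translate_uncurry :
    Measurable fun q : Space d × Config d => translate q.1 q.2 := by
  refine measurable_config fun B hB => ?_
  have : (fun q : Space d × Config d => (translate q.1 q.2).toMeasure B) =
      fun q => q.2.toMeasure {x | x - q.1 ∈ B} := by
    ext q
    rw [toMeasure_translate, Measure.map_apply (by fun_prop) hB]
    rfl
  rw [this]
  exact Measurable.toMeasure_setOf measurable_snd (measurableSet_setOfPred.1
    ((measurable_snd.sub (measurable_fst.comp measurable_fst)) hB))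

theorem Measurable.translate {α : Type*} [MeasurableSpace α] {c : α → Config d}
    {x : α → Space d} (hx : Measurable x) (hc : Measurable c) :
    Measurable fun a => PointFoil.translate (x a) (c a) :=
  measurable_translate_uncurry.comp (hx.prodMk hc)

/-! ### Extension of point-shifts to all of the space -/

/-- Add the origin to a configuration. -/
def pad (φ : Config d) : Config0 d :=
  ⟨⟨insert 0 φ.carrier, fun B hB => by
    rw [Set.insert_eq, Set.union_inter_distrib_right]
    exact ((Set.finite_singleton _).inter_of_left B).union (φ.finite_inter B hB)⟩,
    Set.mem_insert _ _⟩

theorem pad_val (φ : Config0 d) : pad φ.1 = φ :=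
  Subtype.ext (Config.ext (Set.insert_eq_of_mem φ.2))

theorem pad_translate {φ : Config d} (x : φ.carrier) : pad (translate x.1 φ) = recenter φ x :=
  pad_val (recenter φ x)

open Classical in
theorem measurable_pad : Measurable (pad (d := d)) := by
  refine Measurable.subtype_mk (measurable_config fun B hB => ?_)
  have : ∀ φ : Config d, (pad φ).1.toMeasure B =
      φ.toMeasure B + if 0 ∈ B ∧ 0 ∉ φ.carrier then 1 else 0 := by
    intro φ
    rw [Config.toMeasure_apply, Config.toMeasure_apply]
    change Measure.count (B ∩ insert 0 φ.carrier) = _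
    by_cases h0 : (0 : Space d) ∈ φ.carrier
    · simp [Set.insert_eq_of_mem h0, h0]
    · by_cases hB0 : (0 : Space d) ∈ B
      · rw [Set.inter_insert_of_mem hB0, Set.insert_eq, Set.union_comm, measure_union]
        · simp [h0, hB0]
        · rw [Set.disjoint_singleton_right]
          exact fun h => h0 h.2
        · exact measurableSet_singleton _
      · simp [Set.inter_insert_of_notMem hB0, hB0]
  change Measurable fun φ : Config d => (pad φ).1.toMeasure B
  simp_rw [this]
  refine ((Measure.measurable_coe hB).comp measurable_toMeasure).add
    (Measurable.ite ?_ measurable_const measurable_const)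
  exact measurableSet_setOfPred.2 (measurable_const.and
    (Measurable.mem_config measurable_id measurable_const).not)

namespace PointMap

variable (f : PointMap d)

/-- The point-shift of `f`, extended to all points of the space. -/
def field (φ : Config d) (x : Space d) : Space d := f.toFun (pad (translate x φ)) + x

/-- The domain of `shift` depends on `φ`; the extension `field` has a fixed domain, so joint
measurability in configuration and point makes sense. Padding changes nothing at points of `φ`. -/
theorem field_coe {φ : Config d} (x : φ.carrier) : f.field φ x.1 = (f.shift φ x).1 := by
  rw [field, pad_translate]
  rfl

theorem iterate_field_coe {φ : Config d} (n : ℕ) (x : φ.carrier) :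
    (f.field φ)^[n] x.1 = ((f.shift φ)^[n] x).1 := by
  induction n generalizing x with
  | zero => rfl
  | succ n ih => rw [Function.iterate_succ_apply, Function.iterate_succ_apply, field_coe, ih]

theorem field_translate (t : Space d) (φ : Config d) (x : Space d) :
    f.field (translate t φ) (x - t) = f.field φ x - t := by
  simp only [field, translate_translate, sub_add_cancel]
  abel

theorem iterate_field_translate (t : Space d) (φ : Config d) (n : ℕ) (x : Space d) :
    (f.field (translate t φ))^[n] (x - t) = (f.field φ)^[n] x - t := by
  induction n generalizing x with
  | zero => rfl
  | succ n ih => rw [Function.iterate_succ_apply, Function.iterate_succ_apply, field_translate, ih]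

theorem measurable_field : Measurable fun q : Config d × Space d => f.field q.1 q.2 :=
  (f.measurable'.comp (measurable_pad.comp
    (Measurable.translate measurable_snd measurable_fst))).add measurable_snd

theorem measurable_iterate_field (n : ℕ) :
    Measurable fun q : Config d × Space d => (f.field q.1)^[n] q.2 := by
  induction n with
  | zero => exact measurable_snd
  | succ n ih =>
    simp_rw [Function.iterate_succ_apply]
    exact ih.comp (measurable_fst.prodMk f.measurable_field)

end PointMap

/-! ### The mass transport principle -/

theorem measurableSet_unitCube : MeasurableSet (unitCube d) := by
  have : unitCube d = ⋂ i, (fun x : Space d => x i) ⁻¹' Set.Ico 0 1 := by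
    ext x
    simp [unitCube]
  rw [this]
  exact MeasurableSet.iInter fun i =>
    (by fun_prop : Measurable fun x : Space d => x i) measurableSet_Ico

/-- The integer points of the space. -/
def intVec (z : Fin d → ℤ) : Space d := WithLp.toLp 2 fun i => (z i : ℝ)

@[simp] theorem intVec_apply (z : Fin d → ℤ) (i : Fin d) : intVec z i = z i := rfl

/-- The unit cube with corner `z`. -/
def cell (z : Fin d → ℤ) : Set (Space d) := {x | x - intVec z ∈ unitCube d}

theorem mem_cell {z : Fin d → ℤ} {x : Space d} : x ∈ cell z ↔ ∀ i, ⌊x i⌋ = z i := by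
  simp only [cell, unitCube, Set.mem_ofPred_eq, Int.floor_eq_iff, Set.mem_Ico]
  refine forall_congr' fun i => ?_
  simp [sub_lt_iff_lt_add, add_comm]

theorem measurableSet_cell (z : Fin d → ℤ) : MeasurableSet (cell z) :=
  (measurable_id.sub_const (intVec z)) measurableSet_unitCube

theorem cell_zero : cell (0 : Fin d → ℤ) = unitCube d := by
  ext x
  simp [cell, show intVec (0 : Fin d → ℤ) = 0 by ext; simp]

theorem setOf_sub_intVec_mem_cell (w z : Fin d → ℤ) :
    {x | x - intVec w ∈ cell z} = cell (z + w) := by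
  ext x
  simp only [Set.mem_ofPred_eq, mem_cell, PiLp.sub_apply, intVec_apply, Int.floor_sub_intCast,
    Pi.add_apply, sub_eq_iff_eq_add]

theorem iUnion_cell : ⋃ z : Fin d → ℤ, cell z = Set.univ :=
  Set.eq_univ_of_forall fun x => Set.mem_iUnion.2 ⟨fun i => ⌊x i⌋, mem_cell.2 fun _ => rfl⟩

theorem pairwise_disjoint_cell :
    Pairwise (Function.onFun Disjoint (cell : (Fin d → ℤ) → Set (Space d))) := by
  intro z w hzw
  refine Set.disjoint_left.2 fun x hx hy => hzw (funext fun i => ?_)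
  rw [← mem_cell.1 hx i, mem_cell.1 hy i]

theorem lintegral_eq_tsum_cell (m : Measure (Space d)) (u : Space d → ℝ≥0∞) :
    ∫⁻ x, u x ∂m = ∑' z : Fin d → ℤ, ∫⁻ x in cell z, u x ∂m := by
  rw [← lintegral_iUnion measurableSet_cell pairwise_disjoint_cell, iUnion_cell,
    Measure.restrict_univ]

theorem setLIntegral_translate (t : Space d) (φ : Config d) {A : Set (Space d)}
    (hA : MeasurableSet A) {u : Space d → ℝ≥0∞} (hu : Measurable u) :
    ∫⁻ x in A, u x ∂(translate t φ).toMeasure =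
      ∫⁻ x in {x | x - t ∈ A}, u (x - t) ∂φ.toMeasure := by
  rw [toMeasure_translate, setLIntegral_map hA hu (by fun_prop)]
  rfl

theorem Measurable.setLIntegral_config {α : Type*} [MeasurableSpace α] {c : α → Config d}
    (hc : Measurable c) {A : Set (Space d)} (hA : MeasurableSet A) {g : α → Space d → ℝ≥0∞}
    (hg : Measurable fun q : α × Space d => g q.1 q.2) :
    Measurable fun a => ∫⁻ x in A, g a x ∂(c a).toMeasure := by
  simp_rw [← lintegral_indicator hA]
  refine Measurable.lintegral_config hc (g := fun a => A.indicator (g a)) ?_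
  exact (hg.indicator (measurable_snd hA))

theorem lintegral_ite_one {α : Type*} [MeasurableSpace α] (m : Measure α) {p : α → Prop}
    [DecidablePred p] (hp : Measurable p) : ∫⁻ y, (if p y then 1 else 0) ∂m = m {y | p y} := by
  rw [← lintegral_indicator_one (measurableSet_setOfPred.2 hp)]
  exact lintegral_congr fun y => by simp [Set.indicator_apply]

variable {μ : Measure (Config d)}

/-- By stationarity the mean mass sent from cell `0` to cell `z` is that sent from cell `-z` to cell
`0`; it remains to sum over `z`. -/
theorem mass_transport (hμ : ∀ t, MeasurePreserving (translate t) μ μ)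
    {g : Config d → Space d → Space d → ℝ≥0∞}
    (hg : Measurable fun q : Config d × Space d × Space d => g q.1 q.2.1 q.2.2)
    (inv : ∀ t φ x y, g (translate t φ) (x - t) (y - t) = g φ x y) :
    ∫⁻ φ, ∫⁻ x in unitCube d, ∫⁻ y, g φ x y ∂φ.toMeasure ∂φ.toMeasure ∂μ =
      ∫⁻ φ, ∫⁻ y in unitCube d, ∫⁻ x, g φ x y ∂φ.toMeasure ∂φ.toMeasure ∂μ := by
  have hg' : ∀ φ : Config d, Measurable fun q : Space d × Space d => g φ q.1 q.2 := fun φ =>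
    hg.comp (measurable_const.prodMk measurable_id)
  have hx : ∀ z : Fin d → ℤ,
      Measurable fun q : Config d × Space d => ∫⁻ y in cell z, g q.1 q.2 y ∂q.1.toMeasure :=
    fun z => Measurable.setLIntegral_config measurable_fst (measurableSet_cell z)
      (g := fun q y => g q.1 q.2 y) (hg.comp ((measurable_fst.comp measurable_fst).prodMk
        ((measurable_snd.comp measurable_fst).prodMk measurable_snd)))
  have hy : ∀ z : Fin d → ℤ,
      Measurable fun q : Config d × Space d => ∫⁻ x in cell z, g q.1 x q.2 ∂q.1.toMeasure :=
    fun z => Measurable.setLIntegral_config measurable_fst (measurableSet_cell z)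
      (g := fun q x => g q.1 x q.2) (hg.comp ((measurable_fst.comp measurable_fst).prodMk
        (measurable_snd.prodMk (measurable_snd.comp measurable_fst))))
  have hQx : ∀ z w : Fin d → ℤ, Measurable fun φ : Config d =>
      ∫⁻ x in cell w, ∫⁻ y in cell z, g φ x y ∂φ.toMeasure ∂φ.toMeasure :=
    fun z w => Measurable.setLIntegral_config measurable_id (measurableSet_cell w) (hx z)
  have hQy : ∀ z w : Fin d → ℤ, Measurable fun φ : Config d =>
      ∫⁻ y in cell w, ∫⁻ x in cell z, g φ x y ∂φ.toMeasure ∂φ.toMeasure :=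
    fun z w => Measurable.setLIntegral_config measurable_id (measurableSet_cell w) (hy z)
  have key : ∀ z : Fin d → ℤ,
      ∫⁻ φ, ∫⁻ x in cell 0, ∫⁻ y in cell z, g φ x y ∂φ.toMeasure ∂φ.toMeasure ∂μ =
      ∫⁻ φ, ∫⁻ y in cell 0, ∫⁻ x in cell (-z), g φ x y ∂φ.toMeasure ∂φ.toMeasure ∂μ := by
    intro z
    rw [← (hμ (intVec (-z))).lintegral_comp (hQx z 0)]
    refine lintegral_congr fun φ => ?_
    rw [setLIntegral_translate (u := fun x => ∫⁻ y in cell z, g (translate (intVec (-z)) φ) x y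
        ∂(translate (intVec (-z)) φ).toMeasure) _ _ (measurableSet_cell 0)
      ((hx z).comp (measurable_const.prodMk measurable_id)), setOf_sub_intVec_mem_cell, zero_add]
    have h1 : ∀ x, ∫⁻ y in cell z, g (translate (intVec (-z)) φ) (x - intVec (-z)) y
        ∂(translate (intVec (-z)) φ).toMeasure = ∫⁻ y in cell 0, g φ x y ∂φ.toMeasure := by
      intro x
      rw [setLIntegral_translate (u := fun y => g (translate (intVec (-z)) φ) (x - intVec (-z)) y)
        _ _ (measurableSet_cell z) ((hg' _).comp (measurable_const.prodMk measurable_id)),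
        setOf_sub_intVec_mem_cell, add_neg_cancel]
      simp_rw [inv]
    simp_rw [h1]
    exact lintegral_lintegral_swap (hg' φ).aemeasurable
  rw [← cell_zero]
  have hl : ∀ φ : Config d, ∫⁻ x in cell 0, ∫⁻ y, g φ x y ∂φ.toMeasure ∂φ.toMeasure =
      ∑' z, ∫⁻ x in cell 0, ∫⁻ y in cell z, g φ x y ∂φ.toMeasure ∂φ.toMeasure := by
    intro φ
    have hm : ∀ z : Fin d → ℤ, Measurable fun x => ∫⁻ y in cell z, g φ x y ∂φ.toMeasure :=
      fun z => (hx z).comp (measurable_const.prodMk measurable_id)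
    rw [← lintegral_tsum fun z => (hm z).aemeasurable]
    exact lintegral_congr fun x => lintegral_eq_tsum_cell _ _
  have hr : ∀ φ : Config d, ∫⁻ y in cell 0, ∫⁻ x, g φ x y ∂φ.toMeasure ∂φ.toMeasure =
      ∑' z, ∫⁻ y in cell 0, ∫⁻ x in cell z, g φ x y ∂φ.toMeasure ∂φ.toMeasure := by
    intro φ
    have hm : ∀ z : Fin d → ℤ, Measurable fun y => ∫⁻ x in cell z, g φ x y ∂φ.toMeasure :=
      fun z => (hy z).comp (measurable_const.prodMk measurable_id)
    rw [← lintegral_tsum fun z => (hm z).aemeasurable]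
    exact lintegral_congr fun x => lintegral_eq_tsum_cell _ _
  simp_rw [hl, hr]
  rw [lintegral_tsum fun z => (hQx z 0).aemeasurable,
    lintegral_tsum fun z => (hQy z 0).aemeasurable]
  simp_rw [key]
  exact (Equiv.neg (Fin d → ℤ)).tsum_eq fun z =>
    ∫⁻ φ, ∫⁻ y in cell 0, ∫⁻ x in cell z, g φ x y ∂φ.toMeasure ∂φ.toMeasure ∂μ

/-- An invariant property which holds almost surely for the points of the unit cube holds almost
surely for all points. -/
theorem ae_forall_of_ae_unitCube (hμ : ∀ t, MeasurePreserving (translate t) μ μ)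
    {p : Config d → Space d → Prop} (inv : ∀ t φ x, p (translate t φ) (x - t) ↔ p φ x)
    (h : ∀ᵐ φ ∂μ, ∀ x ∈ φ.carrier, x ∈ unitCube d → p φ x) :
    ∀ᵐ φ ∂μ, ∀ x ∈ φ.carrier, p φ x := by
  have h' : ∀ᵐ φ ∂μ, ∀ z : Fin d → ℤ, ∀ x ∈ (translate (intVec z) φ).carrier,
      x ∈ unitCube d → p (translate (intVec z) φ) x :=
    ae_all_iff.2 fun z => (hμ (intVec z)).quasiMeasurePreserving.ae h
  filter_upwards [h'] with φ hφ x hx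
  rw [← inv (intVec fun i => ⌊x i⌋)]
  exact hφ _ _ (by simpa [mem_translate] using hx) (mem_cell.2 fun _ => rfl)

section Rel

variable {T : Config d → Space d → Space d → Prop}

theorem measurable_mass_out
    (hT : Measurable fun q : Config d × Space d × Space d => T q.1 q.2.1 q.2.2) :
    Measurable fun q : Config d × Space d => q.1.toMeasure {y | T q.1 q.2 y} := by
  have h := hT.comp (by fun_prop : Measurable fun q : (Config d × Space d) × Space d =>
    (q.1.1, q.1.2, q.2))
  exact Measurable.toMeasure_setOf measurable_fst (p := fun q y => T q.1 q.2 y) h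

theorem measurable_mass_in
    (hT : Measurable fun q : Config d × Space d × Space d => T q.1 q.2.1 q.2.2) :
    Measurable fun q : Config d × Space d => q.1.toMeasure {x | T q.1 x q.2} := by
  have h := hT.comp (by fun_prop : Measurable fun q : (Config d × Space d) × Space d =>
    (q.1.1, q.2, q.1.2))
  exact Measurable.toMeasure_setOf measurable_fst (p := fun q x => T q.1 x q.2) h

/-- The mass transport principle for a relation. -/
theorem mass_transport_rel (hμ : ∀ t, MeasurePreserving (translate t) μ μ)
    (hT : Measurable fun q : Config d × Space d × Space d => T q.1 q.2.1 q.2.2)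
    (inv : ∀ t φ x y, T (translate t φ) (x - t) (y - t) ↔ T φ x y) :
    ∫⁻ φ, ∫⁻ x in unitCube d, φ.toMeasure {y | T φ x y} ∂φ.toMeasure ∂μ =
      ∫⁻ φ, ∫⁻ y in unitCube d, φ.toMeasure {x | T φ x y} ∂φ.toMeasure ∂μ := by
  classical
  have hmtp := mass_transport hμ (g := fun φ x y => if T φ x y then 1 else 0)
    (Measurable.ite (measurableSet_setOfPred.2 hT) measurable_const measurable_const)
    (fun t φ x y => by simp only [inv])
  have hout : ∀ φ : Config d, ∀ x, ∫⁻ y, (if T φ x y then 1 else 0) ∂φ.toMeasure =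
      φ.toMeasure {y | T φ x y} := fun φ x => lintegral_ite_one _ (p := fun y => T φ x y)
    (hT.comp (measurable_const.prodMk (measurable_const.prodMk measurable_id)))
  have hin : ∀ φ : Config d, ∀ y, ∫⁻ x, (if T φ x y then 1 else 0) ∂φ.toMeasure =
      φ.toMeasure {x | T φ x y} := fun φ y => lintegral_ite_one _ (p := fun x => T φ x y)
    (hT.comp (measurable_const.prodMk (measurable_id.prodMk measurable_const)))
  simpa only [hout, hin] using hmtp

end Rel

/-- In a stationary process of finite intensity where each point sends at most one unit of mass,
almost surely all points receive a finite mass. -/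
theorem ae_finite_of_subsingleton (hμ : ∀ t, MeasurePreserving (translate t) μ μ)
    (hfin : ∫⁻ φ, φ.toMeasure (unitCube d) ∂μ ≠ ∞) {T : Config d → Space d → Space d → Prop}
    (hT : Measurable fun q : Config d × Space d × Space d => T q.1 q.2.1 q.2.2)
    (inv : ∀ t φ x y, T (translate t φ) (x - t) (y - t) ↔ T φ x y)
    (hsub : ∀ φ : Config d, ∀ x ∈ φ.carrier, ({y | T φ x y} ∩ φ.carrier).Subsingleton) :
    ∀ᵐ φ ∂μ, ∀ y ∈ φ.carrier, ({x | T φ x y} ∩ φ.carrier).Finite := by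
  have hmtp := mass_transport_rel hμ hT inv
  have hm := measurable_mass_in hT
  -- The mean mass leaving the cube is at most the intensity. By transport so is the mean mass
  -- received there, which is then almost surely finite at each point of the cube.
  have hle : ∫⁻ φ, ∫⁻ x in unitCube d, φ.toMeasure {y | T φ x y} ∂φ.toMeasure ∂μ ≤
      ∫⁻ φ, φ.toMeasure (unitCube d) ∂μ := by
    refine lintegral_mono fun φ => ?_
    calc _ ≤ ∫⁻ x in unitCube d, 1 ∂φ.toMeasure := by
          refine lintegral_mono_ae (ae_restrict_of_ae ?_)
          exact φ.ae_toMeasure.2 fun x hx => φ.toMeasure_le_one (hsub φ x hx)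
      _ = _ := by simp
  rw [hmtp] at hle
  have hlt := ae_lt_top (Measurable.setLIntegral_config measurable_id measurableSet_unitCube hm)
    (hle.trans_lt hfin.lt_top).ne
  refine ae_forall_of_ae_unitCube hμ (p := fun φ y => ({x | T φ x y} ∩ φ.carrier).Finite) ?_ ?_
  · intro t φ y
    rw [← Set.finite_image_iff (f := fun x => x + t) (add_left_injective t).injOn]
    have : (fun x => x + t) '' ({x | T (translate t φ) x (y - t)} ∩ (translate t φ).carrier) =
        {x | T φ x y} ∩ φ.carrier := by
      ext x
      constructor
      · rintro ⟨x, ⟨h1, h2⟩, rfl⟩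
        exact ⟨(inv t φ _ y).1 (by simpa using h1), h2⟩
      · rintro ⟨h1, h2⟩
        exact ⟨x - t, ⟨(inv t φ x y).2 h1, by simpa [mem_translate] using h2⟩, by simp⟩
    rw [this]
  · filter_upwards [hlt] with φ hφ
    have hm' : Measurable fun y => φ.toMeasure {x | T φ x y} :=
      hm.comp (measurable_const.prodMk measurable_id)
    have h2 := ae_lt_top hm' hφ.ne
    rw [id, ae_restrict_iff' measurableSet_unitCube, φ.ae_toMeasure] at h2
    intro y hy hQ
    have h3 := h2 y hy hQ
    rw [← Set.not_infinite, ← φ.toMeasure_eq_top]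
    exact h3.ne

/-! ### Foils and the depth-first order on foils -/

section Foil

variable {X : Type*} {g : X → X} {x y z : X}

theorem mem_foil_self (g : X → X) (x : X) : x ∈ foil g x := ⟨0, rfl⟩

theorem mem_foil_symm (h : y ∈ foil g x) : x ∈ foil g y := h.imp fun _ => Eq.symm

theorem iterate_eq_of_le {m n : ℕ} (hmn : m ≤ n) (h : g^[m] x = g^[m] y) : g^[n] x = g^[n] y := by
  obtain ⟨k, rfl⟩ := Nat.exists_eq_add_of_le' hmn
  rw [Function.iterate_add_apply, h, Function.iterate_add_apply]

theorem mem_foil_trans (hxy : y ∈ foil g x) (hyz : z ∈ foil g y) : z ∈ foil g x := by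
  obtain ⟨m, hm⟩ := hxy
  obtain ⟨n, hn⟩ := hyz
  exact ⟨max m n, (iterate_eq_of_le (le_max_left m n) hm).trans
    (iterate_eq_of_le (le_max_right m n) hn)⟩

theorem foil_eq_of_mem (h : y ∈ foil g x) : foil g y = foil g x :=
  Set.Subset.antisymm (fun _ hz => mem_foil_trans h hz)
    fun _ hz => mem_foil_trans (mem_foil_symm h) hz

/-- After a number of steps that is a common multiple of both periods and at least the merging time,
each point is back at itself and both coincide. -/
theorem eq_of_mem_periodicPts_of_mem_foil (hx : x ∈ Function.periodicPts g)
    (hy : y ∈ Function.periodicPts g) (h : y ∈ foil g x) : x = y := by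
  obtain ⟨a, ha, hx⟩ := hx
  obtain ⟨b, hb, hy⟩ := hy
  obtain ⟨n, hn⟩ := h
  have h1 : g^[a * b * n] x = x := (hx.mul_const b).mul_const n
  have h2 : g^[a * b * n] y = y := (hy.const_mul a).mul_const n
  rw [← h1, ← h2]
  exact iterate_eq_of_le (Nat.le_mul_of_pos_left n (Nat.mul_pos ha hb)) hn

/-- A foil some of whose points have different heights over a common ancestor has a periodic
point. -/
theorem exists_periodicPts_mem_foil {a b : ℕ} (h : y ∈ foil g x) (hab : g^[a] x = g^[b] y)
    (hne : a ≠ b) : ∃ z ∈ foil g x, z ∈ Function.periodicPts g := by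
  obtain ⟨N, hN⟩ := h
  have hw : g^[a] (g^[N] x) = g^[b] (g^[N] x) := by
    rw [← Function.iterate_add_apply, add_comm, Function.iterate_add_apply, hab,
      ← Function.iterate_add_apply, add_comm, Function.iterate_add_apply, hN]
  have key : ∀ a b : ℕ, a < b → g^[a] (g^[N] x) = g^[b] (g^[N] x) →
      ∃ z ∈ foil g x, z ∈ Function.periodicPts g := by
    intro a b hlt hw
    obtain ⟨p, rfl⟩ := Nat.exists_eq_add_of_lt hlt
    have hv : Function.IsPeriodicPt g (p + 1) (g^[a + N] x) := by
      rw [Function.IsPeriodicPt, Function.IsFixedPt, ← Function.iterate_add_apply,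
        show p + 1 + (a + N) = a + p + 1 + N by omega, Function.iterate_add_apply, ← hw,
        ← Function.iterate_add_apply]
    -- The point `v = g^[a + N] x` has period `p + 1`. Moving it on by `p * (a + N)` steps makes
    -- another `a + N` steps complete a multiple of the period, so the new point meets `x` at `v`.
    refine ⟨g^[p * (a + N)] (g^[a + N] x), ⟨a + N, ?_⟩, p + 1, p.succ_pos, hv.apply_iterate _⟩
    rw [← Function.iterate_add_apply g (a + N) (p * (a + N)),
      show a + N + p * (a + N) = (p + 1) * (a + N) by ring]
    exact (hv.mul_const _).symm
  rcases hne.lt_or_gt with h | h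
  · exact key a b h hw
  · exact key b a h hw.symm

end Foil

/-- The depth-first order of the points of a foil, for a given order of brothers. -/
def prec {X : Type*} (g : X → X) (lt : X → X → Prop) (x y : X) : Prop :=
  ∃ m : ℕ, g^[m + 1] x = g^[m + 1] y ∧ lt (g^[m] x) (g^[m] y)

/-- `y` is the cyclic successor of `x` in its foil, for the depth-first order. -/
def cycSucc {X : Type*} (g : X → X) (lt : X → X → Prop) (x y : X) : Prop :=
  y ∈ foil g x ∧ ((prec g lt x y ∧ ¬ ∃ z, prec g lt x z ∧ prec g lt z y) ∨
    ((¬ ∃ z, prec g lt x z) ∧ ¬ ∃ z, prec g lt z y))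

/-! ### The depth-first order on a foil: totality, finite intervals, cyclic successor -/

section Prec

variable {X : Type*} {g : X → X} {lt : X → X → Prop} {x y z : X}

theorem prec.mem_foil (h : prec g lt x y) : y ∈ foil g x := by
  obtain ⟨m, hm, -⟩ := h
  exact ⟨m + 1, hm⟩

theorem prec_swap : prec g (Function.swap lt) x y ↔ prec g lt y x :=
  exists_congr fun _ => and_congr_left fun _ => eq_comm

/-- Reversing the order of brothers exchanges successors and predecessors, so each fact about
successors has its dual for free. -/
theorem cycSucc_swap : cycSucc g (Function.swap lt) x y ↔ cycSucc g lt y x := by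
  simp only [cycSucc, prec_swap]
  refine and_congr ⟨mem_foil_symm, mem_foil_symm⟩ (or_congr (and_congr_right fun _ => ?_) and_comm)
  exact not_congr (exists_congr fun _ => and_comm)

/-- One step brings the deciding pair of brothers one generation closer, unless the points are
themselves these brothers and merge. -/
theorem prec.map (h : prec g lt x y) : g x = g y ∨ prec g lt (g x) (g y) := by
  obtain ⟨m, hm, hlt⟩ := h
  rcases m with - | m
  · exact Or.inl hm
  · exact Or.inr ⟨m, hm, hlt⟩

variable [IsStrictTotalOrder X lt]

theorem prec_irrefl (x : X) : ¬ prec g lt x x := fun ⟨_, _, h⟩ => irrefl _ h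

/-- The comparison decided at the higher level prevails, because the two points compared at the
lower level have already merged there. The explicit level `max m n` serves again in
`finite_prec_interval`. -/
theorem prec_trans_aux {m n : ℕ} (h1 : g^[m + 1] x = g^[m + 1] y) (h2 : lt (g^[m] x) (g^[m] y))
    (h3 : g^[n + 1] y = g^[n + 1] z) (h4 : lt (g^[n] y) (g^[n] z)) :
    g^[max m n + 1] x = g^[max m n + 1] z ∧ lt (g^[max m n] x) (g^[max m n] z) := by
  refine ⟨(iterate_eq_of_le (by omega) h1).trans (iterate_eq_of_le (by omega) h3), ?_⟩
  rcases lt_trichotomy m n with h | rfl | h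
  · rw [max_eq_right h.le, iterate_eq_of_le h h1]
    exact h4
  · rw [max_self]
    exact _root_.trans h2 h4
  · rw [max_eq_left h.le, ← iterate_eq_of_le h h3]
    exact h2

theorem prec.trans (hxy : prec g lt x y) (hyz : prec g lt y z) : prec g lt x z := by
  obtain ⟨m, h1, h2⟩ := hxy
  obtain ⟨n, h3, h4⟩ := hyz
  exact ⟨max m n, prec_trans_aux h1 h2 h3 h4⟩

theorem prec.asymm (hxy : prec g lt x y) : ¬ prec g lt y x := fun h => prec_irrefl x (hxy.trans h)

instance : IsStrictOrder X (prec g lt) where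
  irrefl := prec_irrefl
  trans _ _ _ := prec.trans

/-- One step before the first merging time the two lines are at distinct points, which `lt`
compares. -/
theorem prec_trichotomy (h : y ∈ foil g x) : prec g lt x y ∨ x = y ∨ prec g lt y x := by
  classical
  by_cases hxy : x = y
  · exact Or.inr (Or.inl hxy)
  have hspec := Nat.find_spec h
  have hmin := fun m => Nat.find_min h (m := m)
  rcases hN : Nat.find h with - | m
  · rw [hN] at hspec
    exact absurd hspec hxy
  rw [hN] at hspec hmin
  rcases trichotomous_of lt (g^[m] x) (g^[m] y) with h1 | h1 | h1
  · exact Or.inl ⟨m, hspec, h1⟩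
  · exact absurd h1 (hmin m m.lt_succ_self)
  · exact Or.inr (Or.inr ⟨m, hspec.symm, h1⟩)

theorem finite_iterate_preimage (hfin : ∀ y, (g ⁻¹' {y}).Finite) (n : ℕ) (w : X) :
    {z | g^[n] z = w}.Finite := by
  induction n generalizing w with
  | zero => exact Set.finite_singleton w
  | succ n ih =>
    have : {z | g^[n + 1] z = w} = ⋃ v ∈ g ⁻¹' {w}, {z | g^[n] z = v} := by
      ext z
      simp [Function.iterate_succ_apply']
    rw [this]
    exact (hfin w).biUnion fun v _ => ih v

/-- A point between `x` and `y` must have merged with them no later than they merge together. It is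
thus among the finitely many descendants of their common ancestor in that generation. -/
theorem finite_prec_interval (hfin : ∀ y, (g ⁻¹' {y}).Finite) (x y : X) :
    {z | prec g lt x z ∧ prec g lt z y}.Finite := by
  by_cases hxy : prec g lt x y
  · obtain ⟨k, hk, hlt⟩ := hxy
    refine (finite_iterate_preimage hfin (k + 1) (g^[k + 1] x)).subset ?_
    rintro z ⟨⟨m, h1, h2⟩, n, h3, h4⟩
    obtain ⟨h5, h6⟩ := prec_trans_aux h1 h2 h3 h4
    have hle : max m n ≤ k := by
      -- If the deciding level exceeded `k`, the lines of `x` and `y` would already coincide there,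
      -- contradicting strictness.
      by_contra! hlt'
      rw [iterate_eq_of_le hlt' hk] at h6
      exact irrefl _ h6
    exact (iterate_eq_of_le (by omega) h1).symm
  · convert Set.finite_empty (α := X)
    exact Set.eq_empty_of_forall_notMem fun z hz => hxy (hz.1.trans hz.2)

theorem exists_prec_minimal {s : Set X} (hs : s.Finite) (hne : s.Nonempty) :
    ∃ a ∈ s, ∀ b ∈ s, ¬ prec g lt b a := by
  obtain ⟨⟨a, ha⟩, -, hmin⟩ := (hs.wellFoundedOn (r := prec g lt)).has_min Set.univ
    ⟨⟨_, hne.some_mem⟩, trivial⟩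
  exact ⟨a, ha, fun b hb => hmin ⟨b, hb⟩ trivial⟩

theorem cycSucc_unique (hy : cycSucc g lt x y) (hz : cycSucc g lt x z) : y = z := by
  have hyz : z ∈ foil g y := mem_foil_trans (mem_foil_symm hy.1) hz.1
  rcases hy.2 with ⟨h1, h2⟩ | ⟨h1, h2⟩ <;> rcases hz.2 with ⟨h3, h4⟩ | ⟨h3, h4⟩
  · rcases prec_trichotomy (lt := lt) hyz with h | h | h
    · exact absurd ⟨y, h1, h⟩ h4
    · exact h
    · exact absurd ⟨z, h3, h⟩ h2
  · exact absurd ⟨_, h1⟩ h3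
  · exact absurd ⟨_, h3⟩ h1
  · rcases prec_trichotomy (lt := lt) hyz with h | h | h
    · exact absurd ⟨_, h⟩ h4
    · exact h
    · exact absurd ⟨_, h⟩ h2

/-- Above a non-maximal point, a finite interval contains a minimal point. If `x` is maximal its
foil is finite, so it has a least point to return to. -/
theorem exists_cycSucc (hfin : ∀ y, (g ⁻¹' {y}).Finite)
    (hmax : ∀ x, (¬ ∃ z, prec g lt x z) → (foil g x).Finite) (x : X) : ∃ y, cycSucc g lt x y := by
  by_cases hx : ∃ z, prec g lt x z
  · obtain ⟨z, hz⟩ := hx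
    obtain ⟨a, ha, hmin⟩ := exists_prec_minimal (g := g) (lt := lt)
      (s := insert z {w | prec g lt x w ∧ prec g lt w z})
      ((finite_prec_interval hfin x z).insert z) (Set.insert_nonempty _ _)
    have hxa : prec g lt x a := by
      rcases ha with rfl | ha
      · exact hz
      · exact ha.1
    refine ⟨a, hxa.mem_foil, Or.inl ⟨hxa, ?_⟩⟩
    rintro ⟨w, hw1, hw2⟩
    refine hmin w (Or.inr ⟨hw1, ?_⟩) hw2
    rcases ha with rfl | ha
    · exact hw2
    · exact hw2.trans ha.2
  · obtain ⟨a, ha, hmin⟩ := exists_prec_minimal (g := g) (lt := lt) (hmax x hx)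
      ⟨x, mem_foil_self g x⟩
    refine ⟨a, ha, Or.inr ⟨hx, ?_⟩⟩
    rintro ⟨w, hw⟩
    exact hmin w (mem_foil_trans ha (mem_foil_symm hw.mem_foil)) hw

end Prec

/-- The almost sure properties of a point-shift from which the cyclic successor of the depth-first
order is built. -/
structure IsTame {X : Type*} (g : X → X) (lt : X → X → Prop) : Prop where
  finite_preimage : ∀ y, (g ⁻¹' {y}).Finite
  finite_of_max : ∀ x, (¬ ∃ z, prec g lt x z) → (foil g x).Finite
  finite_of_min : ∀ x, (¬ ∃ z, prec g lt z x) → (foil g x).Finite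
  finite_of_periodic : ∀ x ∈ Function.periodicPts g, (foil g x).Finite

/-! ### The cyclic successor of a tame self-map: bijectivity, orbits, order -/

namespace IsTame

variable {X : Type*} {g : X → X} {lt : X → X → Prop} {x y z : X}

theorem swap (hg : IsTame g lt) : IsTame g (Function.swap lt) where
  finite_preimage := hg.finite_preimage
  finite_of_max := by simpa only [prec_swap] using hg.finite_of_min
  finite_of_min := by simpa only [prec_swap] using hg.finite_of_max
  finite_of_periodic := hg.finite_of_periodic

variable [IsStrictTotalOrder X lt] (hg : IsTame g lt)

include hg

theorem existsUnique_cycSucc (x : X) : ∃! y, cycSucc g lt x y := by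
  obtain ⟨y, hy⟩ := exists_cycSucc hg.finite_preimage hg.finite_of_max x
  exact ⟨y, hy, fun z hz => cycSucc_unique hz hy⟩

variable {h : X → X} (hh : ∀ x, cycSucc g lt x (h x))

include hh

/-- A predecessor is a successor for the reversed order: uniqueness there gives injectivity,
existence gives surjectivity. -/
theorem bijective : Function.Bijective h := by
  constructor
  · intro x y hxy
    have h1 := hh y
    rw [← hxy] at h1
    exact cycSucc_unique (lt := Function.swap lt) (cycSucc_swap.2 (hh x)) (cycSucc_swap.2 h1)
  · intro y
    obtain ⟨x, hx⟩ := exists_cycSucc hg.swap.finite_preimage hg.swap.finite_of_max y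
    exact ⟨x, cycSucc_unique (hh x) (cycSucc_swap.1 hx)⟩

omit hg [IsStrictTotalOrder X lt] in
theorem preservesFoils : PreservesFoils g h := fun _ => Set.ext fun y =>
  ⟨fun hy => mem_foil_trans hy (mem_foil_symm (hh y).1), fun hy => mem_foil_trans hy (hh y).1⟩

/-- Induction on the number of points strictly between `x` and `y`: replacing `x` by `h x` removes
`h x` from the interval. -/
theorem orbitLE_of_prec (hxy : prec g lt x y) : orbitLE h x y := by
  induction hn : {z | prec g lt x z ∧ prec g lt z y}.ncard using Nat.strong_induction_on
    generalizing x with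
  | _ n ih =>
    rcases (hh x).2 with ⟨h1, h2⟩ | ⟨h1, -⟩
    · rcases prec_trichotomy (lt := lt)
        (mem_foil_trans (mem_foil_symm (hh x).1) hxy.mem_foil) with h3 | h3 | h3
      · obtain ⟨k, hk⟩ := ih _ (by
          rw [← hn]
          refine Set.ncard_lt_ncard ?_ (finite_prec_interval hg.finite_preimage x y)
          refine ⟨fun z hz => ⟨h1.trans hz.1, hz.2⟩, fun hsub => ?_⟩
          exact prec_irrefl _ (hsub ⟨h1, h3⟩).1) h3 rfl
        exact ⟨k + 1, hk⟩
      · exact ⟨1, h3⟩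
      · exact absurd ⟨y, hxy, h3⟩ h2
    · exact absurd ⟨y, hxy⟩ h1

/-- The successor stays in the foil. Conversely two points of a foil are comparable, so one of them
lies on the forward orbit of the other. -/
theorem orbitZ_eq_foil (hb : Function.Bijective h) (x : X) : orbitZ h hb x = foil g x := by
  set σ : Equiv.Perm X := Equiv.ofBijective h hb
  have hσ : ∀ y, σ y = h y := fun _ => rfl
  have hpow : ∀ (n : ℕ) y, (σ ^ n) y = h^[n] y := fun n y => by
    rw [← Equiv.Perm.iterate_eq_pow]
    rfl
  ext y
  constructor
  · rintro ⟨n, rfl⟩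
    change (σ ^ n) x ∈ foil g x
    have hnat : ∀ (n : ℕ) y, (σ ^ n) y ∈ foil g y := by
      intro n y
      induction n with
      | zero => exact mem_foil_self g y
      | succ n ih =>
        rw [pow_succ', Equiv.Perm.mul_apply]
        exact mem_foil_trans ih (hh _).1
    obtain ⟨n, rfl | rfl⟩ := n.eq_nat_or_neg
    · simpa using hnat n x
    · refine mem_foil_symm ?_
      have := hnat n ((σ ^ (-(n : ℤ))) x)
      rwa [← zpow_natCast, ← Equiv.Perm.mul_apply, ← zpow_add, add_neg_cancel, zpow_zero,
        Equiv.Perm.one_apply] at this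
  · intro hy
    rcases prec_trichotomy (lt := lt) hy with h1 | h1 | h1
    · obtain ⟨n, hn⟩ := hg.orbitLE_of_prec hh h1
      refine ⟨n, ?_⟩
      change (σ ^ (n : ℤ)) x = y
      rw [zpow_natCast, hpow, hn]
    · exact ⟨0, h1⟩
    · obtain ⟨n, hn⟩ := hg.orbitLE_of_prec hh h1
      refine ⟨-n, ?_⟩
      change (σ ^ (-(n : ℤ))) x = y
      rw [← hn, ← hpow, ← zpow_natCast, ← Equiv.Perm.mul_apply, ← zpow_add, neg_add_cancel,
        zpow_zero, Equiv.Perm.one_apply]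

/-- An infinite foil has no greatest point, so the successor never wraps around and always goes up.
-/
theorem orbitLE_iff (hx : (foil g x).Infinite) : orbitLE h x y ↔ x = y ∨ prec g lt x y := by
  constructor
  · rintro ⟨n, rfl⟩
    induction n generalizing x with
    | zero => exact Or.inl rfl
    | succ n ih =>
      have h1 : prec g lt x (h x) := by
        rcases (hh x).2 with h1 | h1
        · exact h1.1
        · exact absurd (hg.finite_of_max x h1.1) hx
      rw [Function.iterate_succ_apply]
      rcases ih (x := h x) (by rwa [foil_eq_of_mem (hh x).1]) with h2 | h2
      · rw [← h2]
        exact Or.inr h1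
      · exact Or.inr (h1.trans h2)
  · rintro (rfl | h1)
    · exact ⟨0, rfl⟩
    · exact hg.orbitLE_of_prec hh h1

theorem orbitLE_map (hx : (foil g x).Infinite) (hxy : orbitLE h x y) :
    orbitLE h (g x) (g y) := by
  rcases (hg.orbitLE_iff hh hx).1 hxy with rfl | h1
  · exact ⟨0, rfl⟩
  · rcases h1.map with h2 | h2
    · exact ⟨0, h2⟩
    · exact hg.orbitLE_of_prec hh h2

end IsTame

/-! ### Point-maps selecting a point -/

open Classical in
/-- The point-map which selects the point related to the origin, if there is exactly one, and the
origin otherwise. -/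
def selectPoint (S : Config d → Space d → Space d → Prop)
    (hS : Measurable fun q : Config d × Space d × Space d => S q.1 q.2.1 q.2.2) : PointMap d where
  toFun φ := if h : ∃ y ∈ φ.1.carrier, S φ.1 0 y ∧ ∀ z ∈ φ.1.carrier, S φ.1 0 z → z = y
    then h.choose else 0
  measurable' := by
    intro B hB
    have hc : Measurable fun φ : Config0 d => φ.1 := measurable_subtype_coe
    have hS0 : Measurable fun q : Config0 d × Space d => S q.1.1 0 q.2 :=
      hS.comp ((hc.comp measurable_fst).prodMk (measurable_const.prodMk measurable_snd))
    have hU : Measurable fun q : Config0 d × Space d =>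
        ∀ z ∈ q.1.1.carrier, S q.1.1 0 z → z = q.2 :=
      Measurable.forall_mem_config (hc.comp measurable_fst)
        (p := fun (q : Config0 d × Space d) z => S q.1.1 0 z → z = q.2)
        ((hS0.comp ((measurable_fst.comp measurable_fst).prodMk measurable_snd)).imp
          (measurable_prop_eq measurable_snd (measurable_snd.comp measurable_fst)))
    have hE := Measurable.exists_mem_config hc
      (p := fun (φ : Config0 d) y => S φ.1 0 y ∧ ∀ z ∈ φ.1.carrier, S φ.1 0 z → z = y)
      (hS0.and hU)
    have hB' : Measurable fun q : Config0 d × Space d => q.2 ∈ B :=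
      measurableSet_setOfPred.1 (measurable_snd hB)
    have hEB := Measurable.exists_mem_config hc
      (p := fun (φ : Config0 d) y =>
        (S φ.1 0 y ∧ ∀ z ∈ φ.1.carrier, S φ.1 0 z → z = y) ∧ y ∈ B) ((hS0.and hU).and hB')
    -- Uniqueness removes the choice: the selected point lies in `B` iff some uniquely related point
    -- does. The default value contributes only if `0 ∈ B`.
    convert measurableSet_setOfPred.2
      (hEB.or (hE.not.and (measurable_const (a := (0 : Space d) ∈ B)))) using 1
    ext φ
    simp only [Set.mem_preimage, Set.mem_ofPred_eq]
    split_ifs with h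
    · refine ⟨fun hB => Or.inl ⟨_, h.choose_spec.1, h.choose_spec.2, hB⟩, ?_⟩
      rintro (⟨y, h1, h2, h3⟩ | h1)
      · rwa [h2.2 _ h.choose_spec.1 h.choose_spec.2.1]
      · exact absurd h h1.1
    · refine ⟨fun hB => Or.inr ⟨h, hB⟩, ?_⟩
      rintro (⟨y, h1, h2, h3⟩ | h1)
      · exact absurd ⟨y, h1, h2⟩ h
      · exact h1.2
  mem' φ := by
    split_ifs with h
    · exact h.choose_spec.1
    · exact φ.2

theorem selectPoint_shift {S : Config d → Space d → Space d → Prop}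
    (hS : Measurable fun q : Config d × Space d × Space d => S q.1 q.2.1 q.2.2)
    (inv : ∀ t φ x y, S (translate t φ) (x - t) (y - t) ↔ S φ x y) {φ : Config d}
    {x y : φ.carrier} (hxy : S φ x y) (huniq : ∀ z : φ.carrier, S φ x z → z = y) :
    (selectPoint S hS).shift φ x = y := by
  have h0 : ∀ z, S (translate x.1 φ) 0 z ↔ S φ x (z + x.1) := by
    intro z
    rw [← inv x.1 φ x (z + x.1), sub_self, add_sub_cancel_right]
  have hmem : y.1 - x.1 ∈ (translate x.1 φ).carrier := by
    simp [mem_translate]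
  have hun : ∀ z ∈ (translate x.1 φ).carrier, S (translate x.1 φ) 0 z → z = y.1 - x.1 := by
    intro z hz hS
    rw [eq_sub_iff_add_eq]
    exact congrArg Subtype.val (huniq ⟨z + x.1, hz⟩ ((h0 z).1 hS))
  have hS0 : S (translate x.1 φ) 0 (y.1 - x.1) := by
    rw [h0, sub_add_cancel]
    exact hxy
  have h : ∃ y ∈ (recenter φ x).1.carrier, S (recenter φ x).1 0 y ∧
      ∀ z ∈ (recenter φ x).1.carrier, S (recenter φ x).1 0 z → z = y := ⟨_, hmem, hS0, hun⟩
  refine Subtype.ext ?_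
  change (selectPoint S hS).toFun (recenter φ x) + x.1 = y.1
  have hval : (selectPoint S hS).toFun (recenter φ x) = h.choose := dif_pos h
  rw [hval, hun _ h.choose_spec.1 h.choose_spec.2.1, sub_add_cancel]

/-! ### Orders of brothers -/

/-- A measurable translation-invariant total order of the space. -/
structure IsBrotherOrder (lt : Space d → Space d → Prop) : Prop where
  measurable : Measurable fun q : Space d × Space d => lt q.1 q.2
  sub_right : ∀ x y t, lt (x - t) (y - t) ↔ lt x y
  total : IsStrictTotalOrder (Space d) lt

theorem lexLT_iff {x y : Space d} :
    lexLT x y ↔ ∃ i, (∀ j, j < i → x j = y j) ∧ x i < y i := Iff.rfl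

theorem isBrotherOrder_lexLT : IsBrotherOrder (lexLT (d := d)) where
  measurable := by
    simp_rw [lexLT_iff]
    have hc : ∀ i : Fin d, Measurable fun x : Space d => x i := fun i => by fun_prop
    refine Measurable.exists fun i => (Measurable.forall fun j => measurable_const.imp ?_).and ?_
    · exact measurable_prop_eq ((hc j).comp measurable_fst) ((hc j).comp measurable_snd)
    · exact measurableSet_setOfPred.1
        (measurableSet_lt ((hc i).comp measurable_fst) ((hc i).comp measurable_snd))
  sub_right x y t := by simp [lexLT_iff]
  total :=
    { irrefl := fun x => lt_irrefl (toLex fun i => x i)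
      trans := fun x y z => lt_trans (a := toLex fun i => x i)
      trichotomous := fun x y h1 h2 => by
        have h := le_antisymm (not_lt.1 h2) (not_lt.1 h1)
        ext i
        exact congrFun (toLex.injective h) i }

theorem IsBrotherOrder.swap {lt : Space d → Space d → Prop} (h : IsBrotherOrder lt) :
    IsBrotherOrder (Function.swap lt) where
  measurable := h.measurable.comp measurable_swap
  sub_right x y t := h.sub_right y x t
  total := by
    have := h.total
    exact { irrefl := fun x => irrefl_of lt x
            trans := fun x y z h1 h2 => trans_of lt h2 h1
            trichotomous := fun x y h1 h2 => Std.Trichotomous.trichotomous x y h2 h1 }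

/-- The restriction of a relation to the points of a configuration. -/
def restrictRel (φ : Config d) (lt : Space d → Space d → Prop) (x y : φ.carrier) : Prop :=
  lt x.1 y.1

theorem IsBrotherOrder.restrictRel {lt : Space d → Space d → Prop} (h : IsBrotherOrder lt)
    (φ : Config d) : IsStrictTotalOrder φ.carrier (restrictRel φ lt) := by
  have := h.total
  exact { irrefl := fun x => irrefl_of lt x.1
          trans := fun x y z => trans_of lt
          trichotomous := fun x y h1 h2 => Subtype.ext (Std.Trichotomous.trichotomous _ _ h1 h2) }

/-! ### Foils and the depth-first order are measurable and equivariant -/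

namespace PointMap

variable (f : PointMap d) {lt : Space d → Space d → Prop}

theorem field_mem {φ : Config d} {x : Space d} (hx : x ∈ φ.carrier) : f.field φ x ∈ φ.carrier := by
  rw [f.field_coe ⟨x, hx⟩]
  exact Subtype.coe_prop _

theorem mem_foil_field {φ : Config d} {x y : φ.carrier} :
    y.1 ∈ foil (f.field φ) x.1 ↔ y ∈ foil (f.shift φ) x :=
  exists_congr fun n => by
    rw [f.iterate_field_coe, f.iterate_field_coe, Subtype.ext_iff]

theorem prec_field {φ : Config d} {x y : φ.carrier} :
    prec (f.field φ) lt x.1 y.1 ↔ prec (f.shift φ) (restrictRel φ lt) x y :=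
  exists_congr fun _ => by
    simp only [f.iterate_field_coe, Subtype.ext_iff, restrictRel]

theorem mem_foil_translate (t : Space d) (φ : Config d) (x y : Space d) :
    y - t ∈ foil (f.field (translate t φ)) (x - t) ↔ y ∈ foil (f.field φ) x :=
  exists_congr fun _ => by simp only [f.iterate_field_translate, sub_left_inj]

theorem prec_translate (hlt : IsBrotherOrder lt) (t : Space d) (φ : Config d) (x y : Space d) :
    prec (f.field (translate t φ)) lt (x - t) (y - t) ↔ prec (f.field φ) lt x y :=
  exists_congr fun _ => by simp only [f.iterate_field_translate, sub_left_inj, hlt.sub_right]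

theorem measurable_iterate_field_fst (n : ℕ) :
    Measurable fun q : Config d × Space d × Space d => (f.field q.1)^[n] q.2.1 := by
  have h := (f.measurable_iterate_field n).comp
    (by fun_prop : Measurable fun q : Config d × Space d × Space d => (q.1, q.2.1))
  simpa only [Function.comp_def] using h

theorem measurable_iterate_field_snd (n : ℕ) :
    Measurable fun q : Config d × Space d × Space d => (f.field q.1)^[n] q.2.2 := by
  have h := (f.measurable_iterate_field n).comp
    (by fun_prop : Measurable fun q : Config d × Space d × Space d => (q.1, q.2.2))
  simpa only [Function.comp_def] using h

theorem measurable_mem_foil :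
    Measurable fun q : Config d × Space d × Space d => q.2.2 ∈ foil (f.field q.1) q.2.1 :=
  Measurable.exists fun n => measurable_prop_eq (f.measurable_iterate_field_fst n)
    (f.measurable_iterate_field_snd n)

theorem measurable_prec (hlt : IsBrotherOrder lt) :
    Measurable fun q : Config d × Space d × Space d => prec (f.field q.1) lt q.2.1 q.2.2 :=
  Measurable.exists fun _ => (measurable_prop_eq (f.measurable_iterate_field_fst _)
    (f.measurable_iterate_field_snd _)).and (hlt.measurable.comp
      ((f.measurable_iterate_field_fst _).prodMk (f.measurable_iterate_field_snd _)))

theorem _root_.PointFoil.exists_mem_translate {t : Space d} {φ : Config d}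
    {p : Space d → Prop} :
    (∃ z ∈ (translate t φ).carrier, p z) ↔ ∃ z ∈ φ.carrier, p (z - t) :=
  ⟨fun ⟨z, hz, h⟩ => ⟨z + t, hz, by simpa using h⟩,
    fun ⟨z, hz, h⟩ => ⟨z - t, by simpa [mem_translate] using hz, h⟩⟩

/-- The cyclic successor relation of the points of a configuration, extended to all points. -/
def succRel (lt : Space d → Space d → Prop) (φ : Config d) (x y : Space d) : Prop :=
  y ∈ foil (f.field φ) x ∧
    ((prec (f.field φ) lt x y ∧
      ¬ ∃ z ∈ φ.carrier, prec (f.field φ) lt x z ∧ prec (f.field φ) lt z y) ∨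
    ((¬ ∃ z ∈ φ.carrier, prec (f.field φ) lt x z) ∧ ¬ ∃ z ∈ φ.carrier, prec (f.field φ) lt z y))

theorem succRel_coe {φ : Config d} {x y : φ.carrier} :
    f.succRel lt φ x.1 y.1 ↔ cycSucc (f.shift φ) (restrictRel φ lt) x y := by
  have h : ∀ p : Space d → Prop, (∃ z ∈ φ.carrier, p z) ↔ ∃ z : φ.carrier, p z.1 :=
    fun p => by simp
  simp only [succRel, cycSucc, h, f.prec_field, f.mem_foil_field]

theorem succRel_translate (hlt : IsBrotherOrder lt) (t : Space d) (φ : Config d) (x y : Space d) :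
    f.succRel lt (translate t φ) (x - t) (y - t) ↔ f.succRel lt φ x y := by
  simp only [succRel, exists_mem_translate, f.prec_translate hlt, f.mem_foil_translate]

theorem measurable_exists_prec_fst (hlt : IsBrotherOrder lt) :
    Measurable fun q : Config d × Space d × Space d =>
      ∃ z ∈ q.1.carrier, prec (f.field q.1) lt q.2.1 z :=
  Measurable.exists_mem_config measurable_fst
    (p := fun (q : Config d × Space d × Space d) z => prec (f.field q.1) lt q.2.1 z)
    ((f.measurable_prec hlt).comp
      (by fun_prop : Measurable fun q : (Config d × Space d × Space d) × Space d =>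
        (q.1.1, q.1.2.1, q.2)))

theorem measurable_exists_prec_snd (hlt : IsBrotherOrder lt) :
    Measurable fun q : Config d × Space d × Space d =>
      ∃ z ∈ q.1.carrier, prec (f.field q.1) lt z q.2.2 :=
  Measurable.exists_mem_config measurable_fst
    (p := fun (q : Config d × Space d × Space d) z => prec (f.field q.1) lt z q.2.2)
    ((f.measurable_prec hlt).comp
      (by fun_prop : Measurable fun q : (Config d × Space d × Space d) × Space d =>
        (q.1.1, q.2, q.1.2.2)))

theorem measurable_succRel (hlt : IsBrotherOrder lt) :
    Measurable fun q : Config d × Space d × Space d => f.succRel lt q.1 q.2.1 q.2.2 := by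
  refine f.measurable_mem_foil.and (((f.measurable_prec hlt).and (Measurable.not ?_)).or
    ((f.measurable_exists_prec_fst hlt).not.and (f.measurable_exists_prec_snd hlt).not))
  exact Measurable.exists_mem_config measurable_fst
    (p := fun (q : Config d × Space d × Space d) z =>
      prec (f.field q.1) lt q.2.1 z ∧ prec (f.field q.1) lt z q.2.2)
    (((f.measurable_prec hlt).comp
      (by fun_prop : Measurable fun q : (Config d × Space d × Space d) × Space d =>
        (q.1.1, q.1.2.1, q.2))).and ((f.measurable_prec hlt).comp
      (by fun_prop : Measurable fun q : (Config d × Space d × Space d) × Space d =>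
        (q.1.1, q.2, q.1.2.2))))

/-- The point-map of the successor in the depth-first order, cyclic on the foils with a greatest
point. -/
def succMap (hlt : IsBrotherOrder lt) : PointMap d :=
  selectPoint (f.succRel lt) (f.measurable_succRel hlt)

/-- Tameness makes the related point exist and be unique, so the default value of `selectPoint` is
never taken. -/
theorem cycSucc_succMap (hlt : IsBrotherOrder lt) {φ : Config d}
    (hf : IsTame (f.shift φ) (restrictRel φ lt)) (x : φ.carrier) :
    cycSucc (f.shift φ) (restrictRel φ lt) x ((f.succMap hlt).shift φ x) := by
  have := hlt.restrictRel φ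
  obtain ⟨y, hy, huniq⟩ := hf.existsUnique_cycSucc x
  have h : (f.succMap hlt).shift φ x = y :=
    selectPoint_shift (f.measurable_succRel hlt) (f.succRel_translate hlt) (f.succRel_coe.2 hy)
      fun z hz => huniq z (f.succRel_coe.1 hz)
  rwa [h]

/-! ### Almost sure tameness -/

variable {μ : Measure (Config d)}

/-- Four transports: to the image, and to the greatest, least and periodic points of the foil. -/
theorem ae_isTame (hμ : ∀ t, MeasurePreserving (translate t) μ μ)
    (hfin : ∫⁻ φ, φ.toMeasure (unitCube d) ∂μ ≠ ∞) (hlt : IsBrotherOrder lt) :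
    ∀ᵐ φ ∂μ, IsTame (f.shift φ) (restrictRel φ lt) := by
  have hpre := ae_finite_of_subsingleton hμ hfin (T := fun φ x y => f.field φ x = y)
    (measurable_prop_eq (f.measurable_iterate_field_fst 1)
      (f.measurable_iterate_field_snd 0))
    (fun t φ x y => by rw [f.field_translate, sub_left_inj])
    (fun φ x _ a ha b hb => ha.1.symm.trans hb.1)
  -- If an invariant property singles out at most one point per foil, each point sends its unit to
  -- the selected point, which thus receives one unit from each point of its foil.
  have hsel : ∀ S : Config d → Space d → Prop, (Measurable fun q : Config d × Space d => S q.1 q.2) →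
      (∀ t φ x, S (translate t φ) (x - t) ↔ S φ x) →
      (∀ φ : Config d, ∀ x ∈ φ.carrier, ∀ y ∈ φ.carrier, y ∈ foil (f.field φ) x →
        S φ x → S φ y → x = y) →
      ∀ᵐ φ ∂μ, ∀ x : φ.carrier, S φ x → (foil (f.shift φ) x).Finite := by
    intro S hS inv huniq
    have h := ae_finite_of_subsingleton hμ hfin
      (T := fun φ x y => y ∈ foil (f.field φ) x ∧ S φ y)
      (f.measurable_mem_foil.and
        (hS.comp (measurable_fst.prodMk (measurable_snd.comp measurable_snd))))
      (fun t φ x y => by rw [f.mem_foil_translate, inv])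
      (fun φ x _ a ha b hb => huniq φ a ha.2 b hb.2
        (mem_foil_trans (mem_foil_symm ha.1.1) hb.1.1) ha.1.2 hb.1.2)
    filter_upwards [h] with φ hφ x hx
    refine Set.Finite.of_finite_image (f := Subtype.val) ((hφ x x.2).subset ?_)
      Subtype.val_injective.injOn
    rintro _ ⟨y, hy, rfl⟩
    exact ⟨⟨f.mem_foil_field.2 (mem_foil_symm hy), hx⟩, y.2⟩
  have hmax := hsel (fun φ x => ¬ ∃ z ∈ φ.carrier, prec (f.field φ) lt x z)
    ((f.measurable_exists_prec_fst hlt).comp (by fun_prop :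
      Measurable fun q : Config d × Space d => (q.1, q.2, q.2))).not
    (fun t φ x => by simp only [exists_mem_translate, f.prec_translate hlt])
    (fun φ x hx y hy hxy h1 h2 => by
      have := hlt.total
      rcases prec_trichotomy (lt := lt) hxy with h | h | h
      · exact absurd ⟨y, hy, h⟩ h1
      · exact h
      · exact absurd ⟨x, hx, h⟩ h2)
  have hmin := hsel (fun φ x => ¬ ∃ z ∈ φ.carrier, prec (f.field φ) lt z x)
    ((f.measurable_exists_prec_snd hlt).comp (by fun_prop :
      Measurable fun q : Config d × Space d => (q.1, q.2, q.2))).not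
    (fun t φ x => by simp only [exists_mem_translate, f.prec_translate hlt])
    (fun φ x hx y hy hxy h1 h2 => by
      have := hlt.total
      rcases prec_trichotomy (lt := lt) hxy with h | h | h
      · exact absurd ⟨x, hx, h⟩ h2
      · exact h
      · exact absurd ⟨y, hy, h⟩ h1)
  have hper := hsel (fun φ x => ∃ n : ℕ, 0 < n ∧ (f.field φ)^[n] x = x)
    (Measurable.exists fun n => measurable_const.and
      (measurable_prop_eq (f.measurable_iterate_field n) measurable_snd))
    (fun t φ x => by simp only [f.iterate_field_translate, sub_left_inj])
    (fun φ x _ y _ hxy h1 h2 => eq_of_mem_periodicPts_of_mem_foil h1 h2 hxy)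
  filter_upwards [hpre, hmax, hmin, hper] with φ h1 h2 h3 h4
  have h : ∀ p : Space d → Prop, (∃ z ∈ φ.carrier, p z) ↔ ∃ z : φ.carrier, p z.1 :=
    fun p => by simp
  refine ⟨fun y => ?_, fun x hx => h2 x ?_, fun x hx => h3 x ?_, fun x hx => h4 x ?_⟩
  · refine Set.Finite.of_finite_image (f := Subtype.val) ((h1 y y.2).subset ?_)
      Subtype.val_injective.injOn
    rintro _ ⟨x, rfl, rfl⟩
    exact ⟨f.field_coe x, x.2⟩
  · simpa only [h, f.prec_field] using hx
  · simpa only [h, f.prec_field] using hx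
  · obtain ⟨n, hn, hx⟩ := hx
    exact ⟨n, hn, by rw [f.iterate_field_coe, hx]⟩

end PointMap

/-! ### The royal line of succession -/

/-- Lines of different lengths to a common ancestor would create a periodic point, impossible in an
infinite tame foil. Hence an ancestor inside the foil is the point itself, and merging brothers sit
at equal levels. -/
theorem rlsLE_iff {φ : Config d} {g : φ.carrier → φ.carrier}
    (hg : IsTame g (restrictRel φ lexLT)) {x y : φ.carrier} (hy : y ∈ foil g x)
    (hx : (foil g x).Infinite) : rlsLE g x y ↔ x = y ∨ prec g (restrictRel φ lexLT) x y := by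
  have hacyc : ∀ {a b : ℕ}, g^[a] x = g^[b] y → a = b := by
    intro a b hab
    by_contra hne
    obtain ⟨z, hz, hper⟩ := exists_periodicPts_mem_foil hy hab hne
    refine hx ?_
    rw [← foil_eq_of_mem hz]
    exact hg.finite_of_periodic z hper
  constructor
  · rintro (⟨k, hk⟩ | ⟨m, n, h1, h2⟩)
    · obtain rfl : 0 = k := hacyc hk.symm
      exact Or.inl hk.symm
    · obtain rfl : m = n := by simpa using hacyc h1
      exact Or.inr ⟨m, h1, h2⟩
  · rintro (rfl | ⟨m, h1, h2⟩)
    · exact Or.inl ⟨0, rfl⟩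
    · exact Or.inr ⟨m, m, h1, h2⟩

/-! ### The successor map of a stationary point process -/

section StationaryProcess

variable {Ω : Type*} [MeasurableSpace Ω] {P : Measure Ω} {Φ : Ω → Config d}

theorem IsStationaryPointProcess.measurePreserving (hΦ : IsStationaryPointProcess P Φ)
    (t : Space d) : MeasurePreserving (translate t) (P.map Φ) (P.map Φ) := by
  have hm : Measurable (translate t : Config d → Config d) :=
    Measurable.translate measurable_const measurable_id
  refine ⟨hm, ?_⟩
  rw [Measure.map_map hm hΦ.1]
  exact hΦ.2 t

theorem lintegral_map_intensity (hΦ : Measurable Φ) :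
    ∫⁻ φ, φ.toMeasure (unitCube d) ∂(P.map Φ) = intensity P Φ :=
  lintegral_map ((Measure.measurable_coe measurableSet_unitCube).comp measurable_toMeasure) hΦ

variable (f : PointMap d) {lt : Space d → Space d → Prop}

theorem ae_isTame (hΦ : IsStationaryPointProcess P Φ) (hfin : intensity P Φ ≠ ∞)
    (hlt : IsBrotherOrder lt) : ∀ᵐ ω ∂P, IsTame (f.shift (Φ ω)) (restrictRel (Φ ω) lt) :=
  ae_of_ae_map hΦ.1.aemeasurable
    (f.ae_isTame hΦ.measurePreserving (by rwa [lintegral_map_intensity hΦ.1]) hlt)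

theorem succMap_inFoilStableGroup (hΦ : IsStationaryPointProcess P Φ) (hfin : intensity P Φ ≠ ∞)
    (hlt : IsBrotherOrder lt) : InFoilStableGroup P Φ f (f.succMap hlt) := by
  filter_upwards [ae_isTame f hΦ hfin hlt] with ω hω
  have := hlt.restrictRel (Φ ω)
  exact ⟨hω.bijective (f.cycSucc_succMap hlt hω),
    IsTame.preservesFoils (f.cycSucc_succMap hlt hω)⟩

theorem succMap_isFoilDense (hΦ : IsStationaryPointProcess P Φ) (hfin : intensity P Φ ≠ ∞)
    (hlt : IsBrotherOrder lt) : IsFoilDense P Φ f (f.succMap hlt) := by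
  filter_upwards [ae_isTame f hΦ hfin hlt] with ω hω
  have := hlt.restrictRel (Φ ω)
  exact ⟨hω.bijective (f.cycSucc_succMap hlt hω),
    hω.orbitZ_eq_foil (f.cycSucc_succMap hlt hω) _⟩

theorem succMap_isOrderPreserved (hΦ : IsStationaryPointProcess P Φ) (hfin : intensity P Φ ≠ ∞)
    (hlt : IsBrotherOrder lt) : IsOrderPreserved P Φ f (f.succMap hlt) := by
  filter_upwards [ae_isTame f hΦ hfin hlt] with ω hω x hx y hxy
  have := hlt.restrictRel (Φ ω)
  exact hω.orbitLE_map (f.cycSucc_succMap hlt hω) (hx x ⟨0, 0, rfl⟩) hxy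

theorem succMap_isRoyalLine (hΦ : IsStationaryPointProcess P Φ) (hfin : intensity P Φ ≠ ∞) :
    IsRoyalLine P Φ f (f.succMap isBrotherOrder_lexLT) := by
  filter_upwards [ae_isTame f hΦ hfin isBrotherOrder_lexLT] with ω hω x hx y hy
  have := isBrotherOrder_lexLT.restrictRel (Φ ω)
  have hinf := hx x ⟨0, 0, rfl⟩
  rw [rlsLE_iff hω hy hinf]
  exact hω.orbitLE_iff (f.cycSucc_succMap isBrotherOrder_lexLT hω) hinf

end StationaryProcess

/-! ### The Palm distribution -/

/-- The sum of the Dirac masses at the configurations seen from the points of the unit cube. -/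
def cubeSum (φ : Config d) : Measure (Config0 d) :=
  Measure.sum fun x : {x : φ.carrier // x.1 ∈ unitCube d} => Measure.dirac (recenter φ x.1)

/-- Turns a sum over a type depending on `φ` into an integral against the point kernel, where
measurability in `φ` is available. -/
theorem lintegral_cubeSum (φ : Config d) {G : Config0 d → ℝ≥0∞} (hG : Measurable G) :
    ∫⁻ ψ, G ψ ∂(cubeSum φ) = ∫⁻ x in unitCube d, G (pad (translate x φ)) ∂φ.toMeasure := by
  have h : φ.toMeasure.restrict (unitCube d) =
      Measure.count.restrict (unitCube d ∩ φ.carrier) :=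
    Measure.restrict_restrict measurableSet_unitCube
  rw [cubeSum, lintegral_sum_measure, h,
    lintegral_countable _ (φ.countable_carrier.mono Set.inter_subset_right)]
  simp only [lintegral_dirac' _ hG, Measure.count_singleton, mul_one]
  let e : {x : φ.carrier // x.1 ∈ unitCube d} ≃ ↥(unitCube d ∩ φ.carrier) :=
    { toFun := fun x => ⟨x.1.1, x.2, x.1.2⟩
      invFun := fun x => ⟨⟨x.1, x.2.2⟩, x.2.1⟩
      left_inv := fun _ => rfl
      right_inv := fun _ => rfl }
  rw [← e.tsum_eq]
  refine tsum_congr fun x => ?_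
  rw [← pad_translate]
  rfl

theorem measurable_pad_translate :
    Measurable fun q : Config d × Space d => pad (translate q.2 q.1) :=
  measurable_pad.comp (Measurable.translate measurable_snd measurable_fst)

theorem measurable_cubeSum : Measurable (cubeSum (d := d)) := by
  refine Measure.measurable_of_measurable_coe _ fun B hB => ?_
  have h : ∀ φ : Config d, cubeSum φ B =
      ∫⁻ x in unitCube d, B.indicator 1 (pad (translate x φ)) ∂φ.toMeasure := fun φ => by
    rw [← lintegral_cubeSum φ (measurable_one.indicator hB), lintegral_indicator_one hB]
  simp_rw [h]
  exact Measurable.setLIntegral_config measurable_id measurableSet_unitCube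
    (g := fun φ x => B.indicator 1 (pad (translate x φ)))
    ((measurable_one.indicator hB).comp measurable_pad_translate)

section StationaryProcess

variable {Ω : Type*} [MeasurableSpace Ω] {P : Measure Ω} {Φ : Ω → Config d}

theorem lintegral_palm (hΦ : Measurable Φ) {G : Config0 d → ℝ≥0∞} (hG : Measurable G) :
    ∫⁻ ψ, G ψ ∂(palm P Φ) = (intensity P Φ)⁻¹ *
      ∫⁻ ω, ∫⁻ x in unitCube d, G (pad (translate x (Φ ω))) ∂(Φ ω).toMeasure ∂P := by
  change ∫⁻ ψ, G ψ ∂((intensity P Φ)⁻¹ • P.bind fun ω => cubeSum (Φ ω)) = _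
  rw [lintegral_smul_measure, Measure.lintegral_bind (μ := fun ω => cubeSum (Φ ω))
    (measurable_cubeSum.comp hΦ).aemeasurable hG.aemeasurable]
  simp_rw [lintegral_cubeSum _ hG]
  rfl

theorem isProbabilityMeasure_palm (hΦ : Measurable Φ) (hfin : intensity P Φ ≠ ∞)
    (hpos : intensity P Φ ≠ 0) : IsProbabilityMeasure (palm P Φ) := by
  constructor
  rw [← lintegral_one, lintegral_palm hΦ (G := fun _ => 1) measurable_const]
  simp only [lintegral_one, Measure.restrict_apply_univ]
  exact ENNReal.inv_mul_cancel hpos hfin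

theorem ae_palm (hΦ : Measurable Φ) {p : Config0 d → Prop} (hp : Measurable p)
    (h : ∀ᵐ ω ∂P, ∀ x : (Φ ω).carrier, p (recenter (Φ ω) x)) : ∀ᵐ ψ ∂(palm P Φ), p ψ := by
  classical
  rw [ae_iff, ← lintegral_ite_one _ hp.not, lintegral_palm hΦ
    (G := fun ψ => if ¬ p ψ then 1 else 0) (Measurable.ite (measurableSet_setOfPred.2 hp.not) measurable_const measurable_const)]
  refine mul_eq_zero_of_right _ ?_
  rw [← lintegral_zero (μ := P)]
  refine lintegral_congr_ae ?_
  filter_upwards [h] with ω hω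
  rw [← lintegral_zero (μ := (Φ ω).toMeasure.restrict (unitCube d))]
  refine lintegral_congr_ae (ae_restrict_of_ae ((Φ ω).ae_toMeasure.2 fun x hx => ?_))
  have := hω ⟨x, hx⟩
  rw [← pad_translate] at this
  simp [this]

theorem mass_transport_process (hΦ : IsStationaryPointProcess P Φ)
    {T : Config d → Space d → Space d → Prop}
    (hT : Measurable fun q : Config d × Space d × Space d => T q.1 q.2.1 q.2.2)
    (inv : ∀ t φ x y, T (translate t φ) (x - t) (y - t) ↔ T φ x y) :
    ∫⁻ ω, ∫⁻ x in unitCube d, (Φ ω).toMeasure {y | T (Φ ω) x y} ∂(Φ ω).toMeasure ∂P =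
      ∫⁻ ω, ∫⁻ y in unitCube d, (Φ ω).toMeasure {x | T (Φ ω) x y} ∂(Φ ω).toMeasure ∂P := by
  have h := mass_transport_rel hΦ.measurePreserving hT inv
  have hout : Measurable fun φ : Config d =>
      ∫⁻ x in unitCube d, φ.toMeasure {y | T φ x y} ∂φ.toMeasure :=
    Measurable.setLIntegral_config measurable_id measurableSet_unitCube (measurable_mass_out hT)
  have hin : Measurable fun φ : Config d =>
      ∫⁻ y in unitCube d, φ.toMeasure {x | T φ x y} ∂φ.toMeasure :=
    Measurable.setLIntegral_config measurable_id measurableSet_unitCube (measurable_mass_in hT)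
  rwa [lintegral_map hout hΦ.1, lintegral_map hin hΦ.1] at h

namespace PointMap

variable (h : PointMap d)

theorem measurable_theta : Measurable h.theta := by
  refine Measurable.subtype_mk ?_
  exact Measurable.translate h.measurable' measurable_subtype_coe

theorem theta_recenter (φ : Config d) (x : φ.carrier) :
    h.theta (recenter φ x) = recenter φ (h.shift φ x) :=
  Subtype.ext (translate_translate _ _ _)

open Classical in
/-- Mecke's theorem: almost surely bijective point-shifts preserve the Palm distribution. -/
theorem measurePreserving_theta (hΦ : IsStationaryPointProcess P Φ)
    (hh : ∀ᵐ ω ∂P, Function.Bijective (h.shift (Φ ω))) :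
    MeasurePreserving h.theta (palm P Φ) (palm P Φ) := by
  refine ⟨h.measurable_theta, ?_⟩
  ext B hB
  rw [Measure.map_apply h.measurable_theta hB]
  have hB' : Measurable fun ψ : Config0 d => ψ ∈ B := measurableSet_setOfPred.1 hB
  have hθB : Measurable fun ψ : Config0 d => h.theta ψ ∈ B :=
    measurableSet_setOfPred.1 (h.measurable_theta hB)
  change palm P Φ {ψ | h.theta ψ ∈ B} = palm P Φ {ψ | ψ ∈ B}
  rw [← lintegral_ite_one _ hB', ← lintegral_ite_one _ hθB,
    lintegral_palm hΦ.1 (G := fun ψ => if ψ ∈ B then 1 else 0)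
      (Measurable.ite hB measurable_const measurable_const),
    lintegral_palm hΦ.1 (G := fun ψ => if h.theta ψ ∈ B then 1 else 0)
      (Measurable.ite (h.measurable_theta hB) measurable_const measurable_const)]
  congr 1
  -- Each `x` sends a unit to its image when the configuration seen from there is in `B`. Mass sent
  -- is the indicator of `B` after `theta`; by bijectivity mass received is the indicator of `B`.
  let T : Config d → Space d → Space d → Prop := fun φ x y =>
    h.field φ x = y ∧ pad (translate y φ) ∈ B
  have hT : Measurable fun q : Config d × Space d × Space d => T q.1 q.2.1 q.2.2 := by
    refine (measurable_prop_eq (h.measurable_iterate_field_fst 1)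
      (h.measurable_iterate_field_snd 0)).and ?_
    have hpad := measurable_pad_translate.comp
      (by fun_prop : Measurable fun q : Config d × Space d × Space d => (q.1, q.2.2))
    exact measurableSet_setOfPred.1 (hpad hB)
  have inv : ∀ t φ x y, T (translate t φ) (x - t) (y - t) ↔ T φ x y := fun t φ x y => by
    simp only [T, h.field_translate, sub_left_inj, translate_translate, sub_add_cancel]
  have hmtp := mass_transport_process hΦ hT inv
  refine Eq.trans (lintegral_congr fun ω => ?_) (hmtp.trans (lintegral_congr_ae ?_))
  · refine lintegral_congr_ae (ae_restrict_of_ae ((Φ ω).ae_toMeasure.2 fun x hx => ?_))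
    have hpad : h.theta (pad (translate x (Φ ω))) = pad (translate (h.field (Φ ω) x) (Φ ω)) := by
      rw [h.field_coe ⟨x, hx⟩, pad_translate, ← theta_recenter, ← pad_translate]
    beta_reduce
    rw [hpad]
    split_ifs with hmem
    · refine ((Φ ω).toMeasure_eq_one (x := h.field (Φ ω) x) (Set.ext fun y => ?_)).symm
      constructor
      · rintro ⟨⟨rfl, -⟩, -⟩
        rfl
      · rintro rfl
        exact ⟨⟨rfl, hmem⟩, h.field_mem hx⟩
    · refine ((Φ ω).toMeasure_eq_zero.2 ?_).symm
      rintro y - ⟨rfl, hy⟩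
      exact hmem hy
  · filter_upwards [hh] with ω hω
    refine lintegral_congr_ae (ae_restrict_of_ae ((Φ ω).ae_toMeasure.2 fun y hy => ?_))
    beta_reduce
    split_ifs with hmem
    · obtain ⟨x, hx⟩ := hω.2 ⟨y, hy⟩
      refine (Φ ω).toMeasure_eq_one (x := x.1) (Set.ext fun z => ?_)
      constructor
      · rintro ⟨⟨hz, -⟩, hz'⟩
        refine congrArg Subtype.val (hω.1 (a₁ := ⟨z, hz'⟩) (a₂ := x) ?_)
        rw [hx]
        exact Subtype.ext ((h.field_coe ⟨z, hz'⟩).symm.trans hz)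
      · rintro rfl
        exact ⟨⟨by rw [h.field_coe, hx], hmem⟩, x.2⟩
    · refine (Φ ω).toMeasure_eq_zero.2 ?_
      rintro x - ⟨-, hx⟩
      exact hmem hx

variable (f : PointMap d)

theorem mem_originFoil {φ : Config0 d} {y : Space d} :
    y ∈ (f.originFoil φ).carrier ↔ y ∈ φ.1.carrier ∧ y ∈ foil (f.field φ.1) 0 := by
  constructor
  · rintro ⟨y, hy, rfl⟩
    exact ⟨y.2, (f.mem_foil_field (x := ⟨0, φ.2⟩)).2 hy⟩
  · rintro ⟨h1, h2⟩
    exact ⟨⟨y, h1⟩, (f.mem_foil_field (x := ⟨0, φ.2⟩) (y := ⟨y, h1⟩)).1 h2, rfl⟩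

theorem measurable_originFoil : Measurable f.originFoil := by
  refine measurable_config fun B hB => ?_
  have h : ∀ φ : Config0 d, (f.originFoil φ).toMeasure B =
      φ.1.toMeasure {y | y ∈ foil (f.field φ.1) 0 ∧ y ∈ B} := fun φ => by
    rw [Config.toMeasure_apply, Config.toMeasure_apply]
    congr 1
    ext y
    simp only [Set.mem_inter_iff, f.mem_originFoil, Set.mem_ofPred_eq]
    tauto
  simp_rw [h]
  refine Measurable.toMeasure_setOf measurable_subtype_coe
    (p := fun (φ : Config0 d) y => y ∈ foil (f.field φ.1) 0 ∧ y ∈ B) (Measurable.and ?_ ?_)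
  · have hm := f.measurable_mem_foil.comp (g := fun q : Config d × Space d × Space d =>
        q.2.2 ∈ foil (f.field q.1) q.2.1) (by fun_prop :
      Measurable fun q : Config0 d × Space d => ((q.1 : Config d), (0 : Space d), q.2))
    simpa only [Function.comp_def] using hm
  · exact measurableSet_setOfPred.1 (measurable_snd hB)

/-- The point `h.toFun φ` has the same foil as the origin; only the point of view moves. -/
theorem originFoil_theta {φ : Config0 d} (hφ : h.toFun φ ∈ foil (f.field φ.1) 0) :
    f.originFoil (h.theta φ) = translate (h.toFun φ) (f.originFoil φ) := by
  ext y
  rw [mem_translate, f.mem_originFoil, f.mem_originFoil, ← foil_eq_of_mem hφ,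
    ← f.mem_foil_translate (h.toFun φ) φ.1 (h.toFun φ) (y + h.toFun φ), sub_self,
    add_sub_cancel_right]
  rfl

theorem identDistrib_originFoil (hΦ : IsStationaryPointProcess P Φ)
    (hh : InFoilStableGroup P Φ f h) :
    IdentDistrib (fun φ : Config0 d => translate (h.toFun φ) (f.originFoil φ)) f.originFoil
      (palm P Φ) (palm P Φ) := by
  have hpres := h.measurePreserving_theta hΦ (hh.mono fun _ => And.left)
  refine ⟨(Measurable.translate h.measurable' f.measurable_originFoil).aemeasurable,
    f.measurable_originFoil.aemeasurable, ?_⟩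
  have hp : Measurable fun φ : Config0 d => h.toFun φ ∈ foil (f.field φ.1) 0 := by
    have hm := f.measurable_mem_foil.comp (g := fun q : Config d × Space d × Space d =>
        q.2.2 ∈ foil (f.field q.1) q.2.1) (measurable_subtype_coe.prodMk
      (measurable_const.prodMk h.measurable') :
        Measurable fun φ : Config0 d => ((φ : Config d), (0 : Space d), h.toFun φ))
    simpa only [Function.comp_def] using hm
  have hae : ∀ᵐ φ ∂(palm P Φ), h.toFun φ ∈ foil (f.field φ.1) 0 := by
    refine ae_palm hΦ.1 hp ?_
    filter_upwards [hh] with ω hω x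
    have hx : h.shift (Φ ω) x ∈ foil (f.shift (Φ ω)) x := by
      have := mem_foil_self (f.shift (Φ ω)) x
      rwa [← hω.2 x] at this
    have := (f.mem_foil_translate x.1 (Φ ω) x.1 (h.shift (Φ ω) x).1).2 (f.mem_foil_field.2 hx)
    rwa [sub_self, show (h.shift (Φ ω) x).1 - x.1 = h.toFun (recenter (Φ ω) x) from
      add_sub_cancel_right _ _] at this
  rw [Measure.map_congr (g := f.originFoil ∘ h.theta)
    (hae.mono fun φ hφ => (originFoil_theta h f hφ).symm),
    ← Measure.map_map f.measurable_originFoil h.measurable_theta, hpres.map_eq]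

end PointMap

end StationaryProcess

/-! ### A superposition of independent shifted lattices -/

/-- The phases of a sequence of lattices, that of index `k` having mesh `2 ^ k`. -/
abbrev Phase (d : ℕ) : Type := ℕ → Fin d → UnitAddCircle

instance (d : ℕ) : SecondCountableTopology (Fin d → UnitAddCircle) := inferInstance

instance (d : ℕ) : BorelSpace (Phase d) :=
  inferInstanceAs (BorelSpace (ℕ → Fin d → UnitAddCircle))

/-- The uniform distribution of the phases. -/
def phaseLaw (d : ℕ) : Measure (Phase d) := Measure.addHaarMeasure ⊤

instance : Measure.IsAddHaarMeasure (phaseLaw d) :=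
  inferInstanceAs (Measure.IsAddHaarMeasure (Measure.addHaarMeasure ⊤))

instance : IsProbabilityMeasure (phaseLaw d) where
  measure_univ := Measure.addHaarMeasure_self (K₀ := (⊤ : TopologicalSpace.PositiveCompacts (Phase d)))

/-- The image of Haar measure under a continuous surjective homomorphism is a Haar probability,
hence uniform on the circle by uniqueness. -/
theorem phaseLaw_preimage {χ : Phase d →+ UnitAddCircle} (hχ : Continuous χ)
    (hsurj : Function.Surjective χ) {A : Set UnitAddCircle} (hA : MeasurableSet A) :
    phaseLaw d (χ ⁻¹' A) = volume A := by
  have h1 := Measure.isAddHaarMeasure_map_of_isFiniteMeasure (phaseLaw d) χ hχ hsurj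
  have h2 : IsProbabilityMeasure (volume : Measure UnitAddCircle) := ⟨UnitAddCircle.measure_univ⟩
  have h3 : IsProbabilityMeasure ((phaseLaw d).map χ) :=
    Measure.isProbabilityMeasure_map hχ.measurable.aemeasurable
  rw [← Measure.isAddHaarMeasure_eq_of_isProbabilityMeasure ((phaseLaw d).map χ) volume,
    Measure.map_apply hχ.measurable hA]

/-- The phases at a point of the space. -/
def phaseAt (x : Space d) : Phase d := fun k i => ((x i / 2 ^ k : ℝ) : UnitAddCircle)

theorem phaseAt_add (x y : Space d) : phaseAt (x + y) = phaseAt x + phaseAt y := by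
  ext k i
  simp [phaseAt, add_div]

/-- The points of index `k`. -/
def layer (u : Phase d) (k : ℕ) : Set (Space d) := {x | phaseAt x k = u k}

theorem mem_layer {u : Phase d} {k : ℕ} {x : Space d} :
    x ∈ layer u k ↔ ∀ i, ((x i / 2 ^ k : ℝ) : UnitAddCircle) = u k i := funext_iff

theorem coe_eq_coe_iff_exists_int {a b : ℝ} :
    (a : UnitAddCircle) = b ↔ ∃ n : ℤ, a = b + n := by
  rw [← sub_eq_zero, ← AddCircle.coe_sub, AddCircle.coe_eq_zero_iff]
  refine exists_congr fun n => ?_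
  rw [zsmul_one, eq_comm, sub_eq_iff_eq_add']

theorem eq_of_mem_layer {u : Phase d} {k : ℕ} {x y : Space d} (hx : x ∈ layer u k)
    (hy : y ∈ layer u k) (h : ∀ i, |x i - y i| < 2 ^ k) : x = y := by
  ext i
  obtain ⟨n, hn⟩ := coe_eq_coe_iff_exists_int.1 ((mem_layer.1 hx i).trans (mem_layer.1 hy i).symm)
  have h2 : (0 : ℝ) < 2 ^ k := by positivity
  have hn' : x i - y i = n * 2 ^ k := by
    field_simp at hn
    linarith
  have h3 := h i
  rw [hn', abs_mul, abs_of_pos h2, mul_lt_iff_lt_one_left h2] at h3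
  have h4 : n = 0 := Int.abs_lt_one_iff.1 (by
    rw [← Int.cast_abs] at h3
    exact_mod_cast h3)
  rw [h4] at hn'
  simp only [Int.cast_zero, zero_mul] at hn'
  linarith

theorem mem_layer_add_intVec {u : Phase d} {k : ℕ} {x : Space d} (hx : x ∈ layer u k)
    (z : Fin d → ℤ) : x + (2 : ℝ) ^ k • intVec z ∈ layer u k := by
  rw [mem_layer] at hx ⊢
  intro i
  rw [← hx i, coe_eq_coe_iff_exists_int]
  refine ⟨z i, ?_⟩
  simp [add_div]

/-- The point of index `k` in a half-open cube of side `2 ^ k`. -/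
theorem exists_mem_layer (u : Phase d) (k : ℕ) (x : Space d) :
    ∃ y ∈ layer u k, ∀ i, 0 ≤ y i - x i ∧ y i - x i < 2 ^ k := by
  have h : ∀ i, ∃ b ∈ Set.Ico (0 : ℝ) 1,
      (b : UnitAddCircle) = u k i - ((x i / 2 ^ k : ℝ) : UnitAddCircle) :=
    fun i => AddCircle.eq_coe_Ico _
  choose b hb hbu using h
  have h2 : (0 : ℝ) < 2 ^ k := by positivity
  refine ⟨WithLp.toLp 2 fun i => x i + 2 ^ k * b i, mem_layer.2 fun i => ?_, fun i => ?_⟩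
  · have : (x i + 2 ^ k * b i) / 2 ^ k = x i / 2 ^ k + b i := by
      field_simp
    change (((x i + 2 ^ k * b i) / 2 ^ k : ℝ) : UnitAddCircle) = _
    rw [this, AddCircle.coe_add, hbu i, add_sub_cancel]
  · change 0 ≤ x i + 2 ^ k * b i - x i ∧ x i + 2 ^ k * b i - x i < 2 ^ k
    rw [add_sub_cancel_left]
    exact ⟨mul_nonneg h2.le (hb i).1, mul_lt_of_lt_one_right h2 (hb i).2⟩

theorem subsingleton_layer_inter_cell (u : Phase d) (k : ℕ) (z : Fin d → ℤ) :
    (layer u k ∩ cell z).Subsingleton := by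
  rintro x ⟨hx, hxz⟩ y ⟨hy, hyz⟩
  refine eq_of_mem_layer hx hy fun i => ?_
  have h1 := Int.abs_sub_lt_one_of_floor_eq_floor ((mem_cell.1 hxz i).trans (mem_cell.1 hyz i).symm)
  exact h1.trans_le (one_le_pow₀ one_le_two)

theorem phaseLaw_eval_le (k : ℕ) (i : Fin d) (a : UnitAddCircle) (ε : ℝ) :
    phaseLaw d {u | u k i ∈ Metric.closedBall a ε} ≤ ENNReal.ofReal (2 * ε) := by
  let χ : Phase d →+ UnitAddCircle :=
    (Pi.evalAddMonoidHom (fun _ : Fin d => UnitAddCircle) i).comp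
      (Pi.evalAddMonoidHom (fun _ : ℕ => Fin d → UnitAddCircle) k)
  have h := phaseLaw_preimage (χ := χ)
    ((continuous_apply i).comp (continuous_apply k)) (fun b => ⟨fun _ _ => b, rfl⟩)
    (Metric.isClosed_closedBall (x := a) (ε := ε)).measurableSet
  change phaseLaw d (χ ⁻¹' Metric.closedBall a ε) ≤ _
  rw [h, AddCircle.volume_closedBall]
  exact ENNReal.ofReal_le_ofReal (min_le_right _ _)

/-- The phases for which some point of index `k` may lie in a given cell. -/
def nearPhase (i : Fin d) (z : Fin d → ℤ) (k : ℕ) : Set (Phase d) :=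
  {u | u k i ∈ Metric.closedBall ((((z i + 1 / 2) / 2 ^ k : ℝ)) : UnitAddCircle) (1 / 2 / 2 ^ k)}

theorem measurableSet_nearPhase (i : Fin d) (z : Fin d → ℤ) (k : ℕ) :
    MeasurableSet (nearPhase i z k) :=
  ((measurable_pi_apply i).comp (measurable_pi_apply k))
    (Metric.isClosed_closedBall (x := ((((z i + 1 / 2) / 2 ^ k : ℝ)) : UnitAddCircle))
      (ε := 1 / 2 / 2 ^ k)).measurableSet

/-- The `i`-th coordinate of a point of the cell is within `1 / 2` of `z i + 1 / 2`; dividing by `2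
^ k` gives the ball. One coordinate already gives summable probabilities `2⁻¹ ^ k`, used both for
local finiteness and for the intensity. -/
theorem mem_nearPhase {i : Fin d} {z : Fin d → ℤ} {k : ℕ} {u : Phase d} {x : Space d}
    (hx : x ∈ layer u k) (hz : x ∈ cell z) : u ∈ nearPhase i z k := by
  rw [nearPhase, Set.mem_ofPred_eq, ← mem_layer.1 hx i, mem_closedBall_iff_norm,
    ← AddCircle.coe_sub, UnitAddCircle.norm_eq, ← sub_div]
  refine (round_le _ 0).trans ?_
  have h2 : (0 : ℝ) < 2 ^ k := by positivity
  rw [Int.cast_zero, sub_zero, abs_div, abs_of_pos h2]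
  refine div_le_div_of_nonneg_right ?_ h2.le
  have h := Int.floor_eq_iff.1 (mem_cell.1 hz i)
  rw [abs_le]
  constructor <;> linarith

theorem phaseLaw_nearPhase_le (i : Fin d) (z : Fin d → ℤ) (k : ℕ) :
    phaseLaw d (nearPhase i z k) ≤ 2⁻¹ ^ k := by
  refine (phaseLaw_eval_le k i _ _).trans (le_of_eq ?_)
  rw [show 2 * (1 / 2 / 2 ^ k : ℝ) = (2⁻¹) ^ k by field_simp; simp, ENNReal.ofReal_pow (by norm_num),
    ENNReal.ofReal_inv_of_pos two_pos, ENNReal.ofReal_ofNat]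

theorem tsum_phaseLaw_nearPhase_le (i : Fin d) (z : Fin d → ℤ) :
    ∑' k, phaseLaw d (nearPhase i z k) ≤ 2 := by
  refine (ENNReal.tsum_le_tsum (phaseLaw_nearPhase_le i z)).trans (le_of_eq ?_)
  rw [ENNReal.tsum_geometric, ENNReal.one_sub_inv_two, inv_inv]

/-- Phases for which the union of the layers is locally finite and no coordinate of two points of
different indices differ by an integer. -/
structure IsGoodPhase (i : Fin d) (u : Phase d) : Prop where
  finite : ∀ z : Fin d → ℤ, {k | (layer u k ∩ cell z).Nonempty}.Finite
  ne : ∀ k l : ℕ, k < l → 2 ^ k • u k i ≠ 2 ^ l • u l i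

/-- Finiteness is the Borel–Cantelli lemma. For distinct indices, `2 ^ k • u k i - 2 ^ l • u l i` is
uniform on the circle, so it vanishes with probability zero. -/
theorem ae_isGoodPhase (i : Fin d) : ∀ᵐ u ∂phaseLaw d, IsGoodPhase i u := by
  have h1 : ∀ᵐ u ∂phaseLaw d, ∀ z : Fin d → ℤ, ∀ᶠ k in Filter.atTop, u ∉ nearPhase i z k :=
    ae_all_iff.2 fun z => ae_eventually_notMem
      ((tsum_phaseLaw_nearPhase_le i z).trans_lt (by simp)).ne
  have h2 : ∀ᵐ u ∂phaseLaw d, ∀ k l : ℕ, k < l → 2 ^ k • u k i ≠ 2 ^ l • u l i := by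
    refine ae_all_iff.2 fun k => ae_all_iff.2 fun l => ?_
    by_cases hkl : k < l
    swap
    · exact Filter.Eventually.of_forall fun u h => absurd h hkl
    let e : ℕ → (Phase d →+ UnitAddCircle) := fun k =>
      (Pi.evalAddMonoidHom (fun _ : Fin d => UnitAddCircle) i).comp
        (Pi.evalAddMonoidHom (fun _ : ℕ => Fin d → UnitAddCircle) k)
    have he : ∀ k, Continuous (e k) := fun k => (continuous_apply i).comp (continuous_apply k)
    let χ : Phase d →+ UnitAddCircle := 2 ^ k • e k - 2 ^ l • e l
    have hχ : Continuous χ := ((he k).const_smul (2 ^ k : ℕ)).sub ((he l).const_smul (2 ^ l : ℕ))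
    have hsurj : Function.Surjective χ := by
      intro b
      obtain ⟨x, -, rfl⟩ := AddCircle.eq_coe_Ico b
      refine ⟨Pi.single k fun _ => ((x / 2 ^ k : ℝ) : UnitAddCircle), ?_⟩
      have hk : (Pi.single k fun _ => ((x / 2 ^ k : ℝ) : UnitAddCircle) : Phase d) l = 0 :=
        Pi.single_eq_of_ne hkl.ne' _
      change 2 ^ k • (Pi.single k (fun _ => ((x / 2 ^ k : ℝ) : UnitAddCircle)) : Phase d) k i -
        2 ^ l • (Pi.single k (fun _ => ((x / 2 ^ k : ℝ) : UnitAddCircle)) : Phase d) l i = _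
      rw [hk, Pi.single_eq_same, Pi.zero_apply, smul_zero, sub_zero, ← AddCircle.coe_nsmul]
      congr 1
      rw [nsmul_eq_mul]
      push_cast
      field_simp
    have h0 := phaseLaw_preimage hχ hsurj
      (Metric.isClosed_closedBall (x := (0 : UnitAddCircle)) (ε := 0)).measurableSet
    rw [AddCircle.volume_closedBall] at h0
    have h0' : phaseLaw d (χ ⁻¹' Metric.closedBall 0 0) = 0 := by simpa using h0
    filter_upwards [measure_eq_zero_iff_ae_notMem.1 h0'] with u hu _ heq
    refine hu ?_
    rw [Set.mem_preimage, Metric.closedBall_zero]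
    exact sub_eq_zero.2 heq
  filter_upwards [h1, h2] with u hu1 hu2
  refine ⟨fun z => ?_, hu2⟩
  have h := hu1 z
  rw [← Nat.cofinite_eq_atTop, Filter.eventually_cofinite] at h
  refine h.subset ?_
  rintro k ⟨x, hx, hz⟩
  simpa using mem_nearPhase hx hz

theorem pow_smul_phase_eq {u : Phase d} {k : ℕ} {x : Space d} (hx : x ∈ layer u k) (i : Fin d) :
    2 ^ k • u k i = ((x i : ℝ) : UnitAddCircle) := by
  rw [← mem_layer.1 hx i, ← AddCircle.coe_nsmul]
  congr 1
  rw [nsmul_eq_mul]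
  push_cast
  field_simp

/-- Points of layer `k` all have the residue `2 ^ k • u k i` modulo one as `i`-th coordinate, so
this residue determines the layer. -/
theorem IsGoodPhase.index_unique {i : Fin d} {u : Phase d} (hu : IsGoodPhase i u) {k l : ℕ}
    {x y : Space d} (hx : x ∈ layer u k) (hy : y ∈ layer u l)
    (hxy : ((x i : ℝ) : UnitAddCircle) = ((y i : ℝ) : UnitAddCircle)) : k = l := by
  rw [← pow_smul_phase_eq hx, ← pow_smul_phase_eq hy] at hxy
  rcases lt_trichotomy k l with h | h | h
  · exact absurd hxy (hu.ne k l h)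
  · exact h
  · exact absurd hxy.symm (hu.ne l k h)

theorem finite_cells {B : Set (Space d)} (hB : Bornology.IsBounded B) :
    {z : Fin d → ℤ | (B ∩ cell z).Nonempty}.Finite := by
  obtain ⟨C, hC⟩ := hB.exists_norm_le
  refine (Set.finite_Icc (fun _ : Fin d => ⌊-C⌋) fun _ => ⌊C⌋).subset ?_
  rintro z ⟨x, hxB, hxz⟩
  have h : ∀ i, |x i| ≤ C := fun i => (PiLp.norm_apply_le x i).trans (hC x hxB)
  constructor <;> intro i
  · rw [← mem_cell.1 hxz i]
    exact Int.floor_mono (abs_le.1 (h i)).1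
  · rw [← mem_cell.1 hxz i]
    exact Int.floor_mono (abs_le.1 (h i)).2

theorem IsGoodPhase.finite_inter {i : Fin d} {u : Phase d} (hu : IsGoodPhase i u)
    (B : Set (Space d)) (hB : Bornology.IsBounded B) : ((⋃ k, layer u k) ∩ B).Finite := by
  refine ((finite_cells hB).biUnion fun z _ => (hu.finite z).biUnion fun k _ =>
    (subsingleton_layer_inter_cell u k z).finite).subset ?_
  rintro x ⟨hx, hxB⟩
  obtain ⟨k, hk⟩ := Set.mem_iUnion.1 hx
  have hz : x ∈ cell fun i => ⌊x i⌋ := mem_cell.2 fun _ => rfl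
  exact Set.mem_biUnion (⟨x, hxB, hz⟩ : (B ∩ cell _).Nonempty)
    (Set.mem_biUnion (⟨x, hk, hz⟩ : (layer u k ∩ cell _).Nonempty) ⟨hk, hz⟩)

/-- A measurable null set outside of which the phases are good. -/
def badPhases (i : Fin d) : Set (Phase d) := toMeasurable (phaseLaw d) {u | ¬ IsGoodPhase i u}

theorem measurableSet_badPhases (i : Fin d) : MeasurableSet (badPhases i) :=
  measurableSet_toMeasurable _ _

theorem isGoodPhase_of_notMem {i : Fin d} {u : Phase d} (hu : u ∉ badPhases i) :
    IsGoodPhase i u := by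
  by_contra h
  exact hu (subset_toMeasurable _ _ h)

theorem ae_notMem_badPhases (i : Fin d) : ∀ᵐ u ∂phaseLaw d, u ∉ badPhases i := by
  rw [← measure_eq_zero_iff_ae_notMem, badPhases, measure_toMeasurable]
  exact ae_isGoodPhase i

open Classical in
/-- The superposition of the layers. -/
def layers (i : Fin d) (u : Phase d) : Config d where
  carrier := if u ∈ badPhases i then ∅ else ⋃ k, layer u k
  finite_inter B hB := by
    split_ifs with h
    · simp
    · exact (isGoodPhase_of_notMem h).finite_inter B hB

theorem layers_carrier {i : Fin d} {u : Phase d} (hu : u ∉ badPhases i) :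
    (layers i u).carrier = ⋃ k, layer u k := if_neg hu

theorem mem_layers {i : Fin d} {u : Phase d} (hu : u ∉ badPhases i) {x : Space d} :
    x ∈ (layers i u).carrier ↔ ∃ k, x ∈ layer u k := by
  rw [layers_carrier hu, Set.mem_iUnion]

/-- An enumeration of the points of the layers. -/
def layerPoint (q : ℕ × (Fin d → ℤ)) (u : Phase d) : Space d :=
  WithLp.toLp 2 fun i => 2 ^ q.1 * ((AddCircle.measurableEquivIco 1 0 (u q.1 i) : ℝ) + q.2 i)

theorem layerPoint_apply (q : ℕ × (Fin d → ℤ)) (u : Phase d) (i : Fin d) : layerPoint q u i =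
    2 ^ q.1 * ((AddCircle.measurableEquivIco 1 0 (u q.1 i) : ℝ) + q.2 i) := rfl

theorem measurable_layerPoint (q : ℕ × (Fin d → ℤ)) : Measurable (layerPoint q) := by
  refine (WithLp.measurable_toLp 2 _).comp (measurable_pi_lambda _ fun i => ?_)
  refine Measurable.const_mul (Measurable.add_const ?_ _) _
  exact measurable_subtype_coe.comp ((AddCircle.measurableEquivIco 1 0).measurable.comp
    ((measurable_pi_apply i).comp (measurable_pi_apply q.1)))

theorem coe_measurableEquivIco (a : UnitAddCircle) :
    ((AddCircle.measurableEquivIco 1 0 a : ℝ) : UnitAddCircle) = a :=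
  (AddCircle.measurableEquivIco 1 0).symm_apply_apply a

theorem mem_layer_iff_exists {u : Phase d} {k : ℕ} {x : Space d} :
    x ∈ layer u k ↔ ∃ z, layerPoint (k, z) u = x := by
  have h2 : (0 : ℝ) < 2 ^ k := by positivity
  rw [mem_layer]
  have h : ∀ i, ((x i / 2 ^ k : ℝ) : UnitAddCircle) = u k i ↔ ∃ n : ℤ,
      2 ^ k * ((AddCircle.measurableEquivIco 1 0 (u k i) : ℝ) + n) = x i := by
    intro i
    conv_lhs => rw [← coe_measurableEquivIco (u k i)]
    rw [coe_eq_coe_iff_exists_int]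
    refine exists_congr fun n => ?_
    rw [div_eq_iff h2.ne', eq_comm, mul_comm]
  simp_rw [h]
  constructor
  · intro hx
    choose z hz using hx
    exact ⟨z, by ext i; exact hz i⟩
  · rintro ⟨z, rfl⟩ i
    exact ⟨z i, rfl⟩

theorem layerPoint_injective {i : Fin d} {u : Phase d} (hu : IsGoodPhase i u) :
    Function.Injective fun q => layerPoint q u := by
  rintro ⟨k, z⟩ ⟨l, w⟩ h
  obtain rfl : k = l := hu.index_unique (mem_layer_iff_exists.2 ⟨z, rfl⟩)
    (mem_layer_iff_exists.2 ⟨w, rfl⟩) (by rw [show layerPoint (k, z) u = layerPoint (l, w) u from h])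
  congr 1
  ext i
  have h1 : layerPoint (k, z) u i = layerPoint (k, w) u i := congrArg (fun x : Space d => x i) h
  rw [layerPoint_apply, layerPoint_apply] at h1
  have h2 : (2 : ℝ) ^ k ≠ 0 := by positivity
  have h3 := add_left_cancel (mul_left_cancel₀ h2 h1)
  exact_mod_cast h3

/-- An injective enumeration, measurable in the phases, turns the number of points in `B` into a
countable sum of measurable indicators. -/
theorem layers_toMeasure_apply {i : Fin d} {u : Phase d} (hu : u ∉ badPhases i)
    (B : Set (Space d)) :
    (layers i u).toMeasure B = ∑' q : ℕ × (Fin d → ℤ), B.indicator 1 (layerPoint q u) := by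
  have hinj := layerPoint_injective (isGoodPhase_of_notMem hu)
  have hrange : (layers i u).carrier = Set.range fun q => layerPoint q u := by
    ext x
    rw [mem_layers hu]
    simp only [mem_layer_iff_exists, Set.mem_range, Prod.exists]
  rw [Config.toMeasure_apply, hrange, ← Set.image_preimage_eq_inter_range,
    Measure.count_injective_image hinj,
    ← lintegral_indicator_one (Set.to_countable _).measurableSet, lintegral_count]
  rfl

theorem measurable_layers (i : Fin d) : Measurable (layers i) := by
  classical
  refine measurable_config fun B hB => ?_
  have h : (fun u => (layers i u).toMeasure B) = fun u => if u ∈ badPhases i then 0 else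
      ∑' q : ℕ × (Fin d → ℤ), B.indicator 1 (layerPoint q u) := by
    ext u
    split_ifs with hu
    · rw [Config.toMeasure_eq_zero]
      simp [layers, hu]
    · exact layers_toMeasure_apply hu B
  rw [h]
  refine Measurable.ite (measurableSet_badPhases i) measurable_const
    (Measurable.tsum fun q => ?_)
  exact (measurable_one.indicator hB).comp (measurable_layerPoint q)

theorem mem_layer_sub {u : Phase d} {k : ℕ} {x t : Space d} :
    x ∈ layer (u - phaseAt t) k ↔ x + t ∈ layer u k := by
  change phaseAt x k = u k - phaseAt t k ↔ phaseAt (x + t) k = u k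
  rw [phaseAt_add, eq_sub_iff_add_eq]
  rfl

/-- Translation by `t` rotates the phases by `phaseAt t`, which preserves Haar measure. Equality is
only almost sure because `badPhases` need not be invariant. -/
theorem layers_isStationary (i : Fin d) : IsStationaryPointProcess (phaseLaw d) (layers i) := by
  refine ⟨measurable_layers i, fun t => ?_⟩
  have hp := measurePreserving_sub_right (phaseLaw d) (phaseAt t)
  have h : (fun u => translate t (layers i u)) =ᵐ[phaseLaw d]
      layers i ∘ fun u => u - phaseAt t := by
    filter_upwards [ae_notMem_badPhases i, hp.quasiMeasurePreserving.ae (ae_notMem_badPhases i)]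
      with u hu hut
    ext x
    rw [mem_translate, mem_layers hu, Function.comp_apply, mem_layers hut]
    exact exists_congr fun k => mem_layer_sub.symm
  rw [Measure.map_congr h, ← Measure.map_map (measurable_layers i) hp.measurable, hp.map_eq]

theorem intensity_layers_le (i : Fin d) : intensity (phaseLaw d) (layers i) ≤ 2 := by
  refine le_trans ?_ (tsum_phaseLaw_nearPhase_le i 0)
  simp_rw [← lintegral_indicator_one (measurableSet_nearPhase i 0 _)]
  rw [← lintegral_tsum fun k =>
    (measurable_one.indicator (measurableSet_nearPhase i 0 k)).aemeasurable]
  refine lintegral_mono_ae ?_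
  filter_upwards [ae_notMem_badPhases i] with u hu
  rw [Config.toMeasure_apply, layers_carrier hu, Set.inter_iUnion]
  refine (measure_iUnion_le _).trans (ENNReal.tsum_le_tsum fun k => ?_)
  have hsub := subsingleton_layer_inter_cell u k 0
  rw [cell_zero, Set.inter_comm] at hsub
  rcases hsub.eq_empty_or_singleton with h | ⟨x, h⟩
  · simp [h]
  · have hx : x ∈ unitCube d ∩ layer u k := h ▸ Set.mem_singleton x
    rw [h, Measure.count_singleton, Set.indicator_of_mem
      (mem_nearPhase hx.2 (by rw [cell_zero]; exact hx.1))]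
    rfl

/-- The layer of index `0` has mesh one, so it meets the unit cube for every phase. -/
theorem intensity_layers_ne_zero (i : Fin d) : intensity (phaseLaw d) (layers i) ≠ 0 := by
  rw [intensity, Ne, lintegral_eq_zero_iff (f := fun u => (layers i u).toMeasure (unitCube d))
    ((Measure.measurable_coe measurableSet_unitCube).comp
      (measurable_toMeasure.comp (measurable_layers i)))]
  intro h
  obtain ⟨u, hu, h0⟩ := ((ae_notMem_badPhases i).and h).exists
  obtain ⟨y, hy, hy'⟩ := exists_mem_layer u 0 0
  refine (Config.toMeasure_eq_zero _).1 h0 y ((mem_layers hu).2 ⟨0, hy⟩) fun i => ?_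
  simpa using hy' i

/-! ### A point-shift all of whose foils are infinite -/

/-- If the foil were finite, it would all merge within some `N` steps. Both preimages of `g^[N + 1]
x` in `L (k + N)` are images under `g^[N]` of points of this foil, hence both equal `g^[N] x`. -/
theorem infinite_foil_of_two_preimages {X : Type*} {g : X → X} {L : ℕ → Set X}
    (hmap : ∀ k, ∀ x ∈ L k, g x ∈ L (k + 1))
    (hpre : ∀ k, ∀ y ∈ L (k + 1), ∃ x ∈ L k, ∃ x' ∈ L k, x ≠ x' ∧ g x = y ∧ g x' = y)
    {k : ℕ} {x : X} (hx : x ∈ L k) : (foil g x).Infinite := by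
  have hsurj : ∀ n, ∀ y ∈ L (k + n), ∃ x ∈ L k, g^[n] x = y := by
    intro n
    induction n with
    | zero => exact fun y hy => ⟨y, hy, rfl⟩
    | succ n ih =>
      intro y hy
      obtain ⟨z, hz, -, -, -, hzy, -⟩ := hpre (k + n) y hy
      obtain ⟨x, hx, hxz⟩ := ih z hz
      exact ⟨x, hx, by rw [Function.iterate_succ_apply', hxz, hzy]⟩
  have hiter : ∀ n, g^[n] x ∈ L (k + n) := by
    intro n
    induction n with
    | zero => exact hx
    | succ n ih =>
      rw [Function.iterate_succ_apply']
      exact hmap _ _ ih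
  intro hfin
  have hN : ∃ N, ∀ y ∈ foil g x, g^[N] x = g^[N] y := by
    choose! n hn using fun y (hy : y ∈ foil g x) => hy
    refine ⟨hfin.toFinset.sup n, fun y hy => iterate_eq_of_le ?_ (hn y hy)⟩
    exact Finset.le_sup (hfin.mem_toFinset.2 hy)
  obtain ⟨N, hN⟩ := hN
  obtain ⟨a, ha, b, hb, hab, hga, hgb⟩ := hpre (k + N) (g^[N + 1] x) (hiter (N + 1))
  have key : ∀ a ∈ L (k + N), g a = g^[N + 1] x → a = g^[N] x := by
    intro a ha hga
    obtain ⟨y, -, hy⟩ := hsurj N a ha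
    rw [← hy]
    refine (hN y ⟨N + 1, ?_⟩).symm
    rw [Function.iterate_succ_apply' g N y, hy, hga]
  exact hab ((key a ha hga).trans (key b hb hgb).symm)

/-- `x` is a point of the lattice of mesh `2 ^ k`, and of no finer one, contained in `φ`. -/
def hasIndex (φ : Config d) (k : ℕ) (x : Space d) : Prop :=
  (∀ z : Fin d → ℤ, x + (2 : ℝ) ^ k • intVec z ∈ φ.carrier) ∧
    ∀ j, j < k → ¬ ∀ z : Fin d → ℤ, x + (2 : ℝ) ^ j • intVec z ∈ φ.carrier

theorem hasIndex_unique {φ : Config d} {k l : ℕ} {x : Space d} (hk : hasIndex φ k x)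
    (hl : hasIndex φ l x) : k = l := by
  rcases lt_trichotomy k l with h | h | h
  · exact absurd hk.1 (hl.2 k h)
  · exact h
  · exact absurd hl.1 (hk.2 l h)

theorem hasIndex_translate {φ : Config d} {k : ℕ} {x t : Space d} :
    hasIndex (translate t φ) k (x - t) ↔ hasIndex φ k x := by
  have h : ∀ a : Space d, x - t + a + t = x + a := fun a => by abel
  simp only [hasIndex, mem_translate, h]

theorem measurable_hasIndex (k : ℕ) :
    Measurable fun q : Config d × Space d => hasIndex q.1 k q.2 := by
  have h : ∀ j : ℕ, Measurable fun q : Config d × Space d =>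
      ∀ z : Fin d → ℤ, q.2 + (2 : ℝ) ^ j • intVec z ∈ q.1.carrier := fun j =>
    Measurable.forall fun z => Measurable.mem_config measurable_fst
      (measurable_snd.add_const ((2 : ℝ) ^ j • intVec z))
  exact (h k).and (Measurable.forall fun j => measurable_const.imp (h j).not)

/-- `y` is the corner of the cube of the next lattice which contains `x`. -/
def isCorner (φ : Config d) (x y : Space d) : Prop :=
  ∃ k, hasIndex φ k x ∧ hasIndex φ (k + 1) y ∧ ∀ i, 0 ≤ x i - y i ∧ x i - y i < 2 ^ (k + 1)

theorem isCorner_translate (t : Space d) (φ : Config d) (x y : Space d) :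
    isCorner (translate t φ) (x - t) (y - t) ↔ isCorner φ x y := by
  simp only [isCorner, hasIndex_translate, PiLp.sub_apply, sub_sub_sub_cancel_right]

theorem measurable_isCorner :
    Measurable fun q : Config d × Space d × Space d => isCorner q.1 q.2.1 q.2.2 := by
  refine Measurable.exists fun k => ?_
  have h1 := (measurable_hasIndex (d := d) k).comp
    (by fun_prop : Measurable fun q : Config d × Space d × Space d => (q.1, q.2.1))
  have h2 := (measurable_hasIndex (d := d) (k + 1)).comp
    (by fun_prop : Measurable fun q : Config d × Space d × Space d => (q.1, q.2.2))
  have hc : ∀ i : Fin d,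
      Measurable fun q : Config d × Space d × Space d => q.2.1 i - q.2.2 i := fun i => by fun_prop
  refine h1.and (h2.and (Measurable.forall fun i => ?_))
  exact (measurableSet_setOfPred.1 (measurableSet_le measurable_const (hc i))).and
    (measurableSet_setOfPred.1 (measurableSet_lt (hc i) measurable_const))

/-- The point-map sending each point to the corner of its cube of the next lattice. -/
def cornerMap (d : ℕ) : PointMap d := selectPoint isCorner measurable_isCorner

/-! ### The corner map on the superposed lattices: indices and infinite foils -/

section Layers

variable {i : Fin d} {u : Phase d} (hu : u ∉ badPhases i)

include hu

/-- A point-map sees the configuration and not the phases, so the index must be read off the points.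
A finer lattice through `x` would contain `x + 2 ^ j e_i`, whose residue puts it in the layer of
`x`; but distinct points of that layer differ by at least `2 ^ k` in some coordinate. -/
theorem hasIndex_of_mem_layer {k : ℕ} {x : Space d} (hx : x ∈ layer u k) :
    hasIndex (layers i u) k x := by
  refine ⟨fun z => (mem_layers hu).2 ⟨k, mem_layer_add_intVec hx z⟩, fun j hj h => ?_⟩
  obtain ⟨l, hl⟩ := (mem_layers hu).1 (h (Pi.single i 1))
  obtain rfl : k = l := by
    refine (isGoodPhase_of_notMem hu).index_unique hx hl ?_
    refine (coe_eq_coe_iff_exists_int.2 ⟨2 ^ j, ?_⟩).symm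
    simp
  have hlt : (2 : ℝ) ^ j < 2 ^ k := pow_lt_pow_right₀ one_lt_two hj
  have h0 := eq_of_mem_layer hl hx fun m => by
    by_cases hm : m = i
    · subst hm
      simpa using hlt
    · simp [hm]
  have h1 := congrArg (fun y : Space d => y i) h0
  simp at h1

theorem hasIndex_iff {k : ℕ} {x : Space d} (hx : x ∈ (layers i u).carrier) :
    hasIndex (layers i u) k x ↔ x ∈ layer u k := by
  refine ⟨fun h => ?_, hasIndex_of_mem_layer hu⟩
  obtain ⟨l, hl⟩ := (mem_layers hu).1 hx
  rwa [hasIndex_unique h (hasIndex_of_mem_layer hu hl)]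

theorem cornerMap_shift {k : ℕ} {x y : (layers i u).carrier} (hx : x.1 ∈ layer u k)
    (hy : y.1 ∈ layer u (k + 1)) (hxy : ∀ i, 0 ≤ x.1 i - y.1 i ∧ x.1 i - y.1 i < 2 ^ (k + 1)) :
    (cornerMap d).shift (layers i u) x = y := by
  refine selectPoint_shift measurable_isCorner isCorner_translate
    ⟨k, hasIndex_of_mem_layer hu hx, hasIndex_of_mem_layer hu hy, hxy⟩ fun z hz => ?_
  obtain ⟨l, hl, hlz, hxz⟩ := hz
  obtain rfl : k = l := hasIndex_unique (hasIndex_of_mem_layer hu hx) hl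
  refine Subtype.ext (eq_of_mem_layer ((hasIndex_iff hu z.2).1 hlz) hy fun i => ?_)
  have h1 := hxy i
  have h2 := hxz i
  rw [abs_lt]
  constructor <;> linarith [h1.1, h1.2, h2.1, h2.2]

theorem infinite_foil_cornerMap (x : (layers i u).carrier) :
    (foil ((cornerMap d).shift (layers i u)) x).Infinite := by
  obtain ⟨k, hk⟩ := (mem_layers hu).1 x.2
  refine infinite_foil_of_two_preimages (L := fun k => {x : (layers i u).carrier | x.1 ∈ layer u k}) ?_ ?_
    (k := k) hk
  · intro k x hx
    -- `exists_mem_layer` finds a point above a given one; the corner lies below, so it is applied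
    -- to the reflected layer and the result is negated.
    obtain ⟨y, hy, hyx⟩ := exists_mem_layer (-u) (k + 1) (-x.1)
    have hy' : -y ∈ layer u (k + 1) := by
      rw [mem_layer] at hy ⊢
      intro j
      have := hy j
      rw [PiLp.neg_apply, neg_div, AddCircle.coe_neg, this]
      simp
    rw [cornerMap_shift hu (y := ⟨-y, (mem_layers hu).2 ⟨_, hy'⟩⟩) hx hy' fun j => ?_]
    · exact hy'
    · simpa [add_comm] using hyx j
  · intro k y hy
    -- The cube of side `2 ^ (k + 1)` at `y` contains the point of layer `k` in its lower subcube of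
    -- side `2 ^ k`, and also the neighbour of that point in direction `i`.
    obtain ⟨x, hx, hxy⟩ := exists_mem_layer u k y.1
    have h2 : (0 : ℝ) < 2 ^ k := by positivity
    have hx' := mem_layer_add_intVec hx (Pi.single i 1)
    refine ⟨⟨x, (mem_layers hu).2 ⟨_, hx⟩⟩, hx, ⟨_, (mem_layers hu).2 ⟨_, hx'⟩⟩, hx', ?_, ?_, ?_⟩
    · intro h
      have h1 := congrArg (fun y : (layers i u).carrier => y.1 i) h
      simp at h1
    · refine cornerMap_shift hu hx hy fun j => ⟨(hxy j).1, ?_⟩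
      rw [pow_succ]
      linarith [(hxy j).2]
    · refine cornerMap_shift hu hx' hy fun j => ?_
      have h3 := hxy j
      rw [pow_succ]
      by_cases hj : j = i
      · subst hj
        simp only [PiLp.add_apply, PiLp.smul_apply, intVec_apply, Pi.single_eq_same, Int.cast_one,
          smul_eq_mul, mul_one]
        constructor <;> linarith [h3.1, h3.2]
      · simp only [PiLp.add_apply, PiLp.smul_apply, intVec_apply, Pi.single_eq_of_ne hj,
          Int.cast_zero, smul_eq_mul, mul_zero, add_zero]
        constructor <;> linarith [h3.1, h3.2]

end Layers

/-- Without wrap-around, one successor lies strictly after `x` and the other strictly before it. -/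
theorem IsTame.ne_of_infinite {X : Type*} {g h h' : X → X} {lt : X → X → Prop}
    [IsStrictTotalOrder X lt] (hg : IsTame g lt) {x : X} (hx : (foil g x).Infinite)
    (hh : cycSucc g lt x (h x)) (hh' : cycSucc g (Function.swap lt) x (h' x)) : h x ≠ h' x := by
  intro heq
  rcases hh.2 with h1 | h1
  · rcases hh'.2 with h2 | h2
    · rw [← heq, prec_swap] at h2
      exact h1.1.asymm h2.1
    · exact hx (hg.swap.finite_of_max x h2.1)
  · exact hx (hg.finite_of_max x h1.1)

end PointFoil

end

theorem mainTheorem2 (d : ℕ) :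
    (∀ (Ω : Type*) [MeasurableSpace Ω] (P : Measure Ω) [IsProbabilityMeasure P]
        (Φ : Ω → PointFoil.Config d),
      PointFoil.IsStationaryPointProcess P Φ → PointFoil.intensity P Φ ≠ ∞ →
      ∀ f : PointFoil.PointMap d,
        (∃ h : PointFoil.PointMap d,
          PointFoil.InFoilStableGroup P Φ f h ∧
          PointFoil.IsFoilDense P Φ f h ∧
          PointFoil.IsOrderPreserved P Φ f h ∧
          PointFoil.IsRoyalLine P Φ f h) ∧
        (PointFoil.intensity P Φ ≠ 0 →
          IsProbabilityMeasure (PointFoil.palm P Φ) ∧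
          ∀ h : PointFoil.PointMap d, PointFoil.InFoilStableGroup P Φ f h →
            MeasurePreserving h.theta (PointFoil.palm P Φ) (PointFoil.palm P Φ) ∧
            IdentDistrib
              (fun φ : PointFoil.Config0 d => PointFoil.translate (h.toFun φ) (f.originFoil φ))
              f.originFoil (PointFoil.palm P Φ) (PointFoil.palm P Φ))) ∧
    (1 ≤ d →
      ∃ (Ω : Type) (_ : MeasurableSpace Ω) (P : Measure Ω) (_ : IsProbabilityMeasure P)
        (Φ : Ω → PointFoil.Config d) (f h₁ h₂ : PointFoil.PointMap d),
        PointFoil.IsStationaryPointProcess P Φ ∧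
        PointFoil.intensity P Φ ≠ ∞ ∧ PointFoil.intensity P Φ ≠ 0 ∧
        (PointFoil.InFoilStableGroup P Φ f h₁ ∧ PointFoil.IsFoilDense P Φ f h₁ ∧
          PointFoil.IsOrderPreserved P Φ f h₁) ∧
        (PointFoil.InFoilStableGroup P Φ f h₂ ∧ PointFoil.IsFoilDense P Φ f h₂ ∧
          PointFoil.IsOrderPreserved P Φ f h₂) ∧
        ¬ ∀ᵐ ω ∂P, h₁.shift (Φ ω) = h₂.shift (Φ ω)) := by
  open PointFoil in
  refine ⟨fun Ω _ P _ Φ hΦ hfin f => ⟨⟨f.succMap isBrotherOrder_lexLT,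
    succMap_inFoilStableGroup f hΦ hfin _, succMap_isFoilDense f hΦ hfin _,
    succMap_isOrderPreserved f hΦ hfin _, succMap_isRoyalLine f hΦ hfin⟩, fun hpos =>
    ⟨isProbabilityMeasure_palm hΦ.1 hfin hpos, fun h hh =>
      ⟨h.measurePreserving_theta hΦ (hh.mono fun _ => And.left),
        h.identDistrib_originFoil f hΦ hh⟩⟩⟩, fun hd => ?_⟩
  let i : Fin d := ⟨0, hd⟩
  have hΦ := PointFoil.layers_isStationary i
  have hfin := ((PointFoil.intensity_layers_le i).trans_lt ENNReal.ofNat_lt_top).ne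
  have hlt := PointFoil.isBrotherOrder_lexLT (d := d)
  let f := PointFoil.cornerMap d
  refine ⟨PointFoil.Phase d, inferInstance, PointFoil.phaseLaw d, inferInstance,
    PointFoil.layers i, f, f.succMap hlt, f.succMap hlt.swap, hΦ, hfin,
    PointFoil.intensity_layers_ne_zero i,
    ⟨PointFoil.succMap_inFoilStableGroup f hΦ hfin hlt,
      PointFoil.succMap_isFoilDense f hΦ hfin hlt,
      PointFoil.succMap_isOrderPreserved f hΦ hfin hlt⟩,
    ⟨PointFoil.succMap_inFoilStableGroup f hΦ hfin hlt.swap,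
      PointFoil.succMap_isFoilDense f hΦ hfin hlt.swap,
      PointFoil.succMap_isOrderPreserved f hΦ hfin hlt.swap⟩, fun hall => ?_⟩
  -- Almost sure equality would hold for some good phase at which tameness holds too; there a single
  -- point of layer `0` already gives a contradiction.
  obtain ⟨u, hu, htame, heq⟩ := ((PointFoil.ae_notMem_badPhases i).and
    ((PointFoil.ae_isTame f hΦ hfin hlt).and hall)).exists
  obtain ⟨y, hy, -⟩ := PointFoil.exists_mem_layer u 0 0
  let x : (PointFoil.layers i u).carrier := ⟨y, (PointFoil.mem_layers hu).2 ⟨0, hy⟩⟩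
  have := hlt.restrictRel (PointFoil.layers i u)
  exact htame.ne_of_infinite (PointFoil.infinite_foil_cornerMap hu x)
    (f.cycSucc_succMap hlt htame x) (f.cycSucc_succMap hlt.swap htame.swap x) (congrFun heq x)
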